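/- **Theorem 3.3.** For a positive semidefinite complex matrix $A$ (written $A\ge0$) let $s(A)$ be its support projection, i.e. the orthogonal projection onto the range of $A$, and let $A^{-1}$ denote the generalized inverse of $A$ (the inverse on the support, $0$ on its complement); for $r<0$ put $A^r:=(A^{-1})^{-r}$. For $0<\alpha<1$ and $p>0$, and for positive semidefinite $n\times n$ matrices $A,B$ with $s(A)\ge s(B)$, define $$A\#_\alpha B:=A^{1/2}(A^{-1/2}BA^{-1/2})^\alpha A^{1/2},\qquad A\#B:=A\#_{1/2}B,$$ $$F_\alpha(A,B):=(A^{-1}\#B)^\alpha A(A^{-1}\#B)^\alpha,\qquad SG_{\alpha,p}(A,B):=F_\alpha(A^p,B^p)^{1/p},$$ $$R_{\alpha,p}(A,B):=\bigl(A^{\frac{1-\alpha}2p}B^{\alpha p}A^{\frac{1-\alpha}2p}\bigr)^{1/p}.$$ For positive semidefinite $n\times n$ matrices $X,Y$ with eigenvalues $\lambda_1(\cdot)\ge\dots\ge\lambda_n(\cdot)$ (counted with multiplicity), $X\prec_{\log}Y$ means that $\prod_{i=1}^k\lambda_i(X)\le\prod_{i=1}^k\lambda_i(Y)$ for $1\le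 k\le n$, with equality for $k=n$. Let $0<\alpha<1$ and $p,q>0$. (1) The following conditions are equivalent: (i) $SG_{\alpha,p}(A,B)\prec_{\log}R_{\alpha,q}(A,B)$ for all $n$ and all positive semidefinite $n\times n$ complex matrices $A,B$ with $s(A)\ge s(B)$; (ii) $SG_{\alpha,p}(A,B)\prec_{\log}R_{\alpha,q}(A,B)$ for all positive definite $2\times2$ complex matrices $A,B$; (iii) $p/q\le\min\{\alpha,1-\alpha\}$. (2) The following conditions are equivalent: (i) $R_{\alpha,q}(A,B)\prec_{\log}SG_{\alpha,p}(A,B)$ for all $n$ and all positive semidefinite $n\times n$ complex matrices $A,B$ with $s(A)\ge s(B)$; (ii) $R_{\alpha,q}(A,B)\prec_{\log}SG_{\alpha,p}(A,B)$ for all positive definite $2\times2$ complex matrices $A,B$; (iii) $p/q\ge\max\{\alpha,1-\alpha\}$. -/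

import Mathlib

open scoped ComplexOrder MatrixOrder

noncomputable section

/-!
Real powers `A ^ r` of a positive semidefinite complex matrix are Mathlib's `CFC.rpow`, that is, the
functional calculus of `x ↦ x ^ r` on `[0, ∞)`. Since `(0 : ℝ≥0) ^ r = 0` for every `r ≠ 0`, a
negative power is the power of the generalized inverse (the inverse on the support of `A`), and
`A ^ (-1 : ℝ)` is the generalized inverse itself.
-/

/-- The support projection `s(A)` of a Hermitian matrix `A`: the spectral projection of `A` for the
nonzero part of the spectrum, that is, the orthogonal projection onto the range of `A`. -/
def supportProj {n : ℕ} (A : Matrix (Fin n) (Fin n) ℂ) : Matrix (Fin n) (Fin n) ℂ :=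
  cfc (fun x : ℝ => if x = 0 then 0 else 1) A

/-- The weighted geometric mean `A #_α B = A^{1/2} (A^{-1/2} B A^{-1/2})^α A^{1/2}`, for positive
definite `A, B` and, with generalized inverses, for positive semidefinite `A, B` with
`s(A) ≥ s(B)` (where it agrees with the limit of `(A + εI) #_α (B + εI)` as `ε ↘ 0`). -/
def geoMean {n : ℕ} (α : ℝ) (A B : Matrix (Fin n) (Fin n) ℂ) : Matrix (Fin n) (Fin n) ℂ :=
  A ^ (1 / 2 : ℝ) * (A ^ (-1 / 2 : ℝ) * B * A ^ (-1 / 2 : ℝ)) ^ α * A ^ (1 / 2 : ℝ)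

/-- The weighted spectral geometric mean `F_α(A, B) = (A⁻¹ # B)^α A (A⁻¹ # B)^α`, with the
generalized inverse of `A` and `# = #_{1/2}`. -/
def spectralGeoMean {n : ℕ} (α : ℝ) (A B : Matrix (Fin n) (Fin n) ℂ) :
    Matrix (Fin n) (Fin n) ℂ :=
  geoMean (1 / 2) (A ^ (-1 : ℝ)) B ^ α * A * geoMean (1 / 2) (A ^ (-1 : ℝ)) B ^ α

/-- The quasi weighted spectral geometric mean `SG_{α,p}(A, B) = F_α(A^p, B^p)^{1/p}`. -/
def SG {n : ℕ} (α p : ℝ) (A B : Matrix (Fin n) (Fin n) ℂ) : Matrix (Fin n) (Fin n) ℂ :=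
  spectralGeoMean α (A ^ p) (B ^ p) ^ (1 / p)

/-- The Rényi mean
`R_{α,p}(A, B) = (A^{(1-α)p/2} B^{αp} A^{(1-α)p/2})^{1/p}`. -/
def renyiMean {n : ℕ} (α p : ℝ) (A B : Matrix (Fin n) (Fin n) ℂ) : Matrix (Fin n) (Fin n) ℂ :=
  (A ^ ((1 - α) / 2 * p) * B ^ (α * p) * A ^ ((1 - α) / 2 * p)) ^ (1 / p)

/-- Log-majorization `X ≺_log Y` of positive semidefinite matrices. Here `eigenvalues₀` lists the
eigenvalues in decreasing order with multiplicities: for `1 ≤ k ≤ n` the product of the `k` largest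
eigenvalues of `X` is at most that of `Y`, with equality for `k = n`. -/
def LogMaj {n : ℕ} (X Y : Matrix (Fin n) (Fin n) ℂ) : Prop :=
  ∃ (hX : X.PosSemidef) (hY : Y.PosSemidef),
    (∀ k : ℕ, 1 ≤ k → k ≤ n →
      ∏ i with i.val < k, hX.isHermitian.eigenvalues₀ i ≤
        ∏ i with i.val < k, hY.isHermitian.eigenvalues₀ i) ∧
    ∏ i, hX.isHermitian.eigenvalues₀ i = ∏ i, hY.isHermitian.eigenvalues₀ i

end

noncomputable section

/-! ### Operator inequalities for powers, and the Riccati equation for `invGeoMean`. -/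

section CStar

open CFC

variable {𝒜 : Type*} [CStarAlgebra 𝒜] [PartialOrder 𝒜] [StarOrderedRing 𝒜]

/-! Compound matrices (exterior powers) commute with products and real powers, hence with both
means, and the norm of the k-th compound of a positive semidefinite matrix is the product of its k
largest eigenvalues. Both means have determinant det(A)^(1-α) det(B)^α when A is positive definite.
So log-majorization reduces to an operator norm inequality, which is proved in a C*-algebra.

Let G = a^(-p) # b^p, the nonnegative solution of G a^p G = b^p. For SG ≺ R and α ≤ 1/2, put t =
‖R^q‖. Then b^(αq) ≤ t a^(-(1-α)q). Löwner–Heinz with exponent p/(αq) ≤ 1, monotonicity of the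
geometric mean, and Löwner–Heinz with exponent 2α ≤ 1 give G^(2α) ≤ t^(p/q) a^(-p), which is the
claim. The case α ≥ 1/2 follows from F_α(x, y) = F_(1-α)(y, x).

For R ≺ SG, put t = ‖F_α(a^p, b^p)‖. Then a^p ≤ t G^(-2α), and the Riccati equation gives b^p ≤ t
G^(2(1-α)). Raising these to the powers (1-α)q/p ≤ 1 and αq/p ≤ 1 produces inverse powers of G,
which cancel in R (`norm_renyiInner_le`).

A singular B is reached by continuity; a singular A is replaced by A + (1 - s(A)), which changes
neither mean because B lives on s(A).

For necessity, take B a rank-one projection in dimension 2 and A^p diagonal with entries 1, 3. With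
s = (1-α)q/p, the norms compare 2^s with (1 + 3^s)/2, so strict convexity or concavity decides
whether s ≥ 1 or s ≤ 1. Exchanging A and B gives the condition with α. -/

lemma smul_rpow_of_nonneg {c : ℝ} (hc : 0 < c) {a : 𝒜} (ha0 : 0 ≤ a) {r : ℝ}
    (h : IsUnit a ∨ 0 ≤ r) : (c • a) ^ r = c ^ r • a ^ r := by
  have h0 : ∀ x ∈ spectrum ℝ a, x ≠ 0 ∨ 0 ≤ r := fun x hx =>
    h.imp_left fun ha hx0 => spectrum.zero_notMem _ ha (hx0 ▸ hx)
  have hcont : ContinuousOn (fun x : ℝ => x ^ r) (spectrum ℝ a) := fun x hx =>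
    (Real.continuousAt_rpow_const _ _ (h0 x hx)).continuousWithinAt
  have hcont' : ContinuousOn (fun x : ℝ => x ^ r) ((fun x => c • x) '' spectrum ℝ a) := by
    rintro _ ⟨x, hx, rfl⟩
    refine (Real.continuousAt_rpow_const _ _ ((h0 x hx).imp_left ?_)).continuousWithinAt
    exact fun hx0 => by simpa [hc.ne'] using hx0
  have hsa : IsSelfAdjoint a := ha0.isSelfAdjoint
  rw [rpow_eq_cfc_real (smul_nonneg hc.le ha0), rpow_eq_cfc_real ha0, ← cfc_smul _ _ _ hcont,
    ← cfc_comp_smul c (fun x : ℝ => x ^ r) a hcont']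
  refine cfc_congr fun x hx => ?_
  have : 0 ≤ x := spectrum_nonneg_of_nonneg ha0 hx
  simp [Real.mul_rpow hc.le this]

lemma smul_rpow_of_pos {c : ℝ} (hc : 0 < c) {a : 𝒜} (ha : IsStrictlyPositive a) (r : ℝ) :
    (c • a) ^ r = c ^ r • a ^ r :=
  smul_rpow_of_nonneg hc ha.nonneg (Or.inl ha.isUnit)

lemma isSelfAdjoint_rpow (a : 𝒜) (r : ℝ) : IsSelfAdjoint (a ^ r) :=
  (rpow_nonneg (a := a) (y := r)).isSelfAdjoint

/-- `‖a^r b^(2s) a^r‖ = ‖b^s a^(2r) b^s‖`, the C*-identity for `b^s a^r`. -/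
lemma norm_rpow_conj_comm {a b : 𝒜} (ha : IsStrictlyPositive a) (hb : IsStrictlyPositive b)
    (r s : ℝ) : ‖a ^ r * b ^ (s + s) * a ^ r‖ = ‖b ^ s * a ^ (r + r) * b ^ s‖ := by
  rw [rpow_add hb.isUnit, rpow_add ha.isUnit]
  have h1 : a ^ r * (b ^ s * b ^ s) * a ^ r = star (b ^ s * a ^ r) * (b ^ s * a ^ r) := by
    simp [(isSelfAdjoint_rpow a r).star_eq, (isSelfAdjoint_rpow b s).star_eq, mul_assoc]
  have h2 : b ^ s * (a ^ r * a ^ r) * b ^ s = (b ^ s * a ^ r) * star (b ^ s * a ^ r) := by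
    simp [(isSelfAdjoint_rpow a r).star_eq, (isSelfAdjoint_rpow b s).star_eq, mul_assoc]
  rw [h1, h2, CStarRing.norm_star_mul_self, CStarRing.norm_self_mul_star]

lemma conj_rpow_le_conj_rpow {c d : 𝒜} (h : c ≤ d) (a : 𝒜) (r : ℝ) :
    a ^ r * c * a ^ r ≤ a ^ r * d * a ^ r :=
  (isSelfAdjoint_rpow a r).conjugate_le_conjugate h

lemma conj_rpow_rpow {a : 𝒜} (ha : IsStrictlyPositive a) (r s : ℝ) :
    a ^ r * a ^ s * a ^ r = a ^ (r + s + r) := by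
  rw [rpow_add ha.isUnit, rpow_add ha.isUnit]

lemma conj_rpow_conj_rpow_neg {a : 𝒜} (ha : IsStrictlyPositive a) (c : 𝒜) (r : ℝ) :
    a ^ r * (a ^ (-r) * c * a ^ (-r)) * a ^ r = c := by
  have h1 := rpow_mul_rpow_neg (a := a) r
  have h2 := rpow_neg_mul_rpow (a := a) r
  calc _ = (a ^ r * a ^ (-r)) * c * (a ^ (-r) * a ^ r) := by simp only [mul_assoc]
    _ = c := by rw [h1, h2, one_mul, mul_one]

/-- From `‖a^r c a^r‖ ≤ t` to `c ≤ t a^(-2r)`. -/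
lemma le_smul_rpow_of_norm_conj_le {a c : 𝒜} (ha : IsStrictlyPositive a) (hc : 0 ≤ c) {r t : ℝ}
    (h : ‖a ^ r * c * a ^ r‖ ≤ t) : c ≤ t • a ^ (-r + -r) := by
  have ht : 0 ≤ t := (norm_nonneg _).trans h
  have h0 : 0 ≤ a ^ r * c * a ^ r := (isSelfAdjoint_rpow a r).conjugate_nonneg hc
  have h1 := (CStarAlgebra.norm_le_iff_le_algebraMap _ ht h0).1 h
  have h2 := conj_rpow_le_conj_rpow h1 a (-r)
  have h3 := conj_rpow_conj_rpow_neg ha c (-r)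
  rw [neg_neg] at h3
  rw [h3, Algebra.algebraMap_eq_smul_one, mul_smul_comm, mul_one, smul_mul_assoc,
    ← rpow_add ha.isUnit] at h2
  exact h2

lemma norm_le_of_le_smul_one {c : 𝒜} (hc : 0 ≤ c) {t : ℝ} (ht : 0 ≤ t) (h : c ≤ t • (1 : 𝒜)) :
    ‖c‖ ≤ t := by
  rw [CStarAlgebra.norm_le_iff_le_algebraMap _ ht hc, Algebra.algebraMap_eq_smul_one]
  exact h

lemma norm_conj_rpow_le {a c : 𝒜} (ha : IsStrictlyPositive a) (hc : 0 ≤ c) {r t : ℝ} (ht : 0 ≤ t)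
    (h : c ≤ t • a ^ (-r + -r)) : ‖a ^ r * c * a ^ r‖ ≤ t := by
  refine norm_le_of_le_smul_one ((isSelfAdjoint_rpow a r).conjugate_nonneg hc) ht ?_
  refine (conj_rpow_le_conj_rpow h a r).trans_eq ?_
  rw [mul_smul_comm, smul_mul_assoc, conj_rpow_rpow ha]
  simp [rpow_zero a ha.nonneg]

/-- Löwner–Heinz. The bounds on p/q enter the norm inequalities only through `u ≤ 1`. -/
lemma le_smul_rpow_of_le {b d : 𝒜} {t u : ℝ} (ht : 0 < t) (hd : IsStrictlyPositive d)
    (hu0 : 0 ≤ u) (hu1 : u ≤ 1) (h : b ≤ t • d) : b ^ u ≤ t ^ u • d ^ u := by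
  rw [← smul_rpow_of_pos ht hd]
  exact rpow_le_rpow ⟨hu0, hu1⟩ h

/-- The mean `x⁻¹ # y` of `x, y`, written with positive powers where possible. -/
def invGeoMean (x y : 𝒜) : 𝒜 :=
  x ^ (-(1 / 2) : ℝ) * (x ^ (1 / 2 : ℝ) * y * x ^ (1 / 2 : ℝ)) ^ (1 / 2 : ℝ) *
    x ^ (-(1 / 2) : ℝ)

/-- `F_α(x, y)`. -/
def specMean (α : ℝ) (x y : 𝒜) : 𝒜 := invGeoMean x y ^ α * x * invGeoMean x y ^ α

lemma IsStrictlyPositive.conj_rpow {a c : 𝒜} (ha : IsStrictlyPositive a)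
    (hc : IsStrictlyPositive c) (r : ℝ) : IsStrictlyPositive (a ^ r * c * a ^ r) :=
  IsStrictlyPositive.iff_of_unital.2 ⟨(isSelfAdjoint_rpow a r).conjugate_nonneg hc.nonneg,
    ((ha.rpow a r).isUnit.mul hc.isUnit).mul (ha.rpow a r).isUnit⟩

lemma isStrictlyPositive_invGeoMean {x y : 𝒜} (hx : IsStrictlyPositive x)
    (hy : IsStrictlyPositive y) : IsStrictlyPositive (invGeoMean x y) :=
  hx.conj_rpow ((hx.conj_rpow hy _).rpow _ _) _

lemma rpow_half_mul_self {a : 𝒜} (ha : 0 ≤ a) : a ^ (1 / 2 : ℝ) * a ^ (1 / 2 : ℝ) = a := by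
  rw [← sqrt_eq_rpow, sqrt_mul_sqrt_self a ha]

/-- The Riccati equation `G x G = y` for `G = x⁻¹ # y`. -/
lemma invGeoMean_mul_mul_self {x y : 𝒜} (hx : IsStrictlyPositive x) (hy : 0 ≤ y) :
    invGeoMean x y * x * invGeoMean x y = y := by
  unfold invGeoMean
  set m := x ^ (1 / 2 : ℝ) * y * x ^ (1 / 2 : ℝ) with hm
  have hm0 : 0 ≤ m := (isSelfAdjoint_rpow x _).conjugate_nonneg hy
  have h1 : x ^ (-(1 / 2) : ℝ) * x * x ^ (-(1 / 2) : ℝ) = 1 := by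
    nth_rw 2 [← rpow_one x hx.nonneg]
    rw [conj_rpow_rpow hx]; norm_num [rpow_zero x hx.nonneg]
  calc _ = x ^ (-(1 / 2) : ℝ) * m ^ (1 / 2 : ℝ) *
        (x ^ (-(1 / 2) : ℝ) * x * x ^ (-(1 / 2) : ℝ)) * m ^ (1 / 2 : ℝ) * x ^ (-(1 / 2) : ℝ) := by
        simp only [mul_assoc]
    _ = x ^ (-(1 / 2) : ℝ) * (m ^ (1 / 2 : ℝ) * m ^ (1 / 2 : ℝ)) * x ^ (-(1 / 2) : ℝ) := by
        rw [h1]; simp only [mul_assoc, mul_one]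
    _ = y := by
        rw [rpow_half_mul_self hm0, hm]
        have := conj_rpow_conj_rpow_neg hx y (-(1 / 2))
        rwa [neg_neg] at this

/-- Uniqueness of the nonnegative solution of the Riccati equation. -/
lemma eq_invGeoMean_of_mul_mul_self {x y g : 𝒜} (hx : IsStrictlyPositive x) (hg : 0 ≤ g)
    (h : g * x * g = y) : invGeoMean x y = g := by
  unfold invGeoMean
  have h0 : 0 ≤ x ^ (1 / 2 : ℝ) * g * x ^ (1 / 2 : ℝ) :=
    (isSelfAdjoint_rpow x _).conjugate_nonneg hg
  have h1 : (x ^ (1 / 2 : ℝ) * g * x ^ (1 / 2 : ℝ)) * (x ^ (1 / 2 : ℝ) * g * x ^ (1 / 2 : ℝ)) =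
      x ^ (1 / 2 : ℝ) * y * x ^ (1 / 2 : ℝ) := by
    rw [← h]
    nth_rw 6 [← rpow_half_mul_self hx.nonneg]
    simp only [mul_assoc]
  rw [← sqrt_eq_rpow, ← h1, sqrt_mul_self _ h0]
  have := conj_rpow_conj_rpow_neg hx g (-(1 / 2))
  rwa [neg_neg] at this

/-- Inverting G x G = y gives G⁻¹ y G⁻¹ = x, and nonnegative solutions are unique. -/
lemma invGeoMean_swap {x y : 𝒜} (hx : IsStrictlyPositive x) (hy : IsStrictlyPositive y) :
    invGeoMean y x = invGeoMean x y ^ (-1 : ℝ) := by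
  have hg := isStrictlyPositive_invGeoMean hx hy
  refine eq_invGeoMean_of_mul_mul_self hy rpow_nonneg ?_
  nth_rw 2 [← invGeoMean_mul_mul_self hx hy.nonneg]
  have h1 : invGeoMean x y ^ (-1 : ℝ) * invGeoMean x y = 1 := by
    nth_rw 2 [← rpow_one (invGeoMean x y) hg.nonneg]
    exact rpow_neg_mul_rpow 1
  have h2 : invGeoMean x y * invGeoMean x y ^ (-1 : ℝ) = 1 := by
    nth_rw 1 [← rpow_one (invGeoMean x y) hg.nonneg]
    exact rpow_mul_rpow_neg 1
  calc _ = (invGeoMean x y ^ (-1 : ℝ) * invGeoMean x y) * x *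
        (invGeoMean x y * invGeoMean x y ^ (-1 : ℝ)) := by simp only [mul_assoc]
    _ = x := by rw [h1, h2, one_mul, mul_one]

/-- `F_α(x, y) = F_{1-α}(y, x)`. -/
lemma specMean_swap {x y : 𝒜} (hx : IsStrictlyPositive x) (hy : IsStrictlyPositive y) (α : ℝ) :
    specMean (1 - α) y x = specMean α x y := by
  have hg := isStrictlyPositive_invGeoMean hx hy
  unfold specMean
  rw [invGeoMean_swap hx hy]
  -- Substituting y = G x G into G^(α-1) y G^(α-1) leaves G^α x G^α.
  nth_rw 2 [← invGeoMean_mul_mul_self hx hy.nonneg]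
  set g := invGeoMean x y
  rw [rpow_rpow g _ _ (by norm_num)]
  have h1 : g ^ (-1 * (1 - α)) * g = g ^ α := by
    nth_rw 2 [← rpow_one g hg.nonneg]
    rw [← rpow_add hg.isUnit]; congr 1; ring
  have h2 : g * g ^ (-1 * (1 - α)) = g ^ α := by
    nth_rw 1 [← rpow_one g hg.nonneg]
    rw [← rpow_add hg.isUnit]; congr 1; ring
  calc _ = (g ^ (-1 * (1 - α)) * g) * x * (g * g ^ (-1 * (1 - α))) := by simp only [mul_assoc]
    _ = _ := by rw [h1, h2]

lemma invGeoMean_le {x y z : 𝒜} (h : y ≤ z) : invGeoMean x y ≤ invGeoMean x z :=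
  conj_rpow_le_conj_rpow (rpow_le_rpow ⟨by norm_num, by norm_num⟩
    (conj_rpow_le_conj_rpow h _ _)) _ _

/-- In the commuting case the Riccati equation is solved by an explicit power. -/
lemma invGeoMean_smul_rpow {a : 𝒜} (ha : IsStrictlyPositive a) {p r c : ℝ} (hc : 0 < c) :
    invGeoMean (a ^ p) (c • a ^ r) = c ^ (1 / 2 : ℝ) • a ^ ((r - p) / 2) := by
  refine eq_invGeoMean_of_mul_mul_self (ha.rpow a p) (smul_nonneg (by positivity) rpow_nonneg) ?_
  have h := conj_rpow_rpow ha ((r - p) / 2) p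
  simp only [smul_mul_assoc, mul_smul_comm, smul_smul, h]
  congr 2
  · rw [← Real.rpow_add hc]; norm_num
  · ring

end CStar

/-! ### The two operator norm inequalities. -/

section CStar

open CFC

variable {𝒜 : Type*} [CStarAlgebra 𝒜] [PartialOrder 𝒜] [StarOrderedRing 𝒜]

/-- `R_{α,q}(a, b)^q`. -/
def renyiInner (α q : ℝ) (a b : 𝒜) : 𝒜 :=
  a ^ ((1 - α) / 2 * q) * b ^ (α * q) * a ^ ((1 - α) / 2 * q)

lemma renyiInner_nonneg (α q : ℝ) (a b : 𝒜) : 0 ≤ renyiInner α q a b :=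
  (isSelfAdjoint_rpow a _).conjugate_nonneg rpow_nonneg

lemma specMean_nonneg (α : ℝ) {x : 𝒜} (hx : 0 ≤ x) (y : 𝒜) : 0 ≤ specMean α x y :=
  (isSelfAdjoint_rpow _ _).conjugate_nonneg hx

lemma isStrictlyPositive_renyiInner {a b : 𝒜} (ha : IsStrictlyPositive a)
    (hb : IsStrictlyPositive b) (α q : ℝ) : IsStrictlyPositive (renyiInner α q a b) :=
  ha.conj_rpow (hb.rpow _ _) _

lemma isStrictlyPositive_specMean {x y : 𝒜} (hx : IsStrictlyPositive x)
    (hy : IsStrictlyPositive y) (α : ℝ) : IsStrictlyPositive (specMean α x y) :=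
  (isStrictlyPositive_invGeoMean hx hy).conj_rpow hx _

lemma norm_renyiInner_swap {a b : 𝒜} (ha : IsStrictlyPositive a) (hb : IsStrictlyPositive b)
    (α q : ℝ) : ‖renyiInner (1 - α) q b a‖ = ‖renyiInner α q a b‖ := by
  have h := norm_rpow_conj_comm ha hb ((1 - α) / 2 * q) ((1 - (1 - α)) / 2 * q)
  rw [show (1 - (1 - α)) / 2 * q + (1 - (1 - α)) / 2 * q = α * q by ring,
    show (1 - α) / 2 * q + (1 - α) / 2 * q = (1 - α) * q by ring] at h
  exact h.symm

lemma norm_specMean_rpow {a y : 𝒜} (ha : IsStrictlyPositive a) (hy : IsStrictlyPositive y)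
    (α p : ℝ) : ‖specMean α (a ^ p) y‖ =
      ‖a ^ (p / 2) * invGeoMean (a ^ p) y ^ (α + α) * a ^ (p / 2)‖ := by
  have hg := isStrictlyPositive_invGeoMean (ha.rpow a p) hy
  rw [norm_rpow_conj_comm ha hg, add_halves]
  rfl

variable {α p q : ℝ}

/-- A bound on `b` by a power of `a` survives each operation that builds `specMean`. The restriction
on α is what permits the power 2α, which turns a^(-p/(2α)) into a^(-p). -/
lemma norm_specMean_le_of_le_half [Nontrivial 𝒜] {a b : 𝒜} (ha : IsStrictlyPositive a)
    (hb : IsStrictlyPositive b) (hα0 : 0 < α) (hα : α ≤ 1 / 2) (hp : 0 < p) (hq : 0 < q)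
    (h : p ≤ α * q) :
    ‖specMean α (a ^ p) (b ^ p)‖ ≤ ‖renyiInner α q a b‖ ^ (p / q) := by
  have hαq : 0 < α * q := mul_pos hα0 hq
  set t := ‖renyiInner α q a b‖ with ht
  have ht0 : 0 < t := norm_pos_iff.2 (isStrictlyPositive_renyiInner ha hb α q).isUnit.ne_zero
  have h1 := le_smul_rpow_of_norm_conj_le ha rpow_nonneg ht.symm.le
  have h2 := le_smul_rpow_of_le ht0 (ha.rpow a _) (u := p / (α * q)) (by positivity)
    ((div_le_one hαq).2 h) h1
  rw [rpow_rpow b _ _ hαq.ne', mul_div_cancel₀ _ hαq.ne'] at h2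
  by_cases hr : -((1 - α) / 2 * q) + -((1 - α) / 2 * q) = 0
  · exfalso; nlinarith
  rw [rpow_rpow a _ _ hr] at h2
  have h3 := invGeoMean_le (x := a ^ p) h2
  rw [invGeoMean_smul_rpow ha (by positivity), ← Real.rpow_mul ht0.le] at h3
  have h4 := le_smul_rpow_of_le (by positivity) (ha.rpow a _) (u := α + α) (by positivity)
    (by linarith) h3
  have he : ((-((1 - α) / 2 * q) + -((1 - α) / 2 * q)) * (p / (α * q)) - p) / 2 =
      -p / (2 * α) := by
    field_simp; ring
  rw [he, rpow_rpow a _ _ (by rw [ne_eq, div_eq_zero_iff]; simp [hp.ne', hα0.ne']),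
    ← Real.rpow_mul ht0.le] at h4
  rw [norm_specMean_rpow ha (hb.rpow b _)]
  refine norm_conj_rpow_le ha rpow_nonneg (by positivity) (h4.trans_eq ?_)
  congr 2
  · field_simp; norm_num
  · field_simp; ring

lemma norm_specMean_le [Nontrivial 𝒜] {a b : 𝒜} (ha : IsStrictlyPositive a)
    (hb : IsStrictlyPositive b) (hα0 : 0 < α) (hα1 : α < 1) (hp : 0 < p) (hq : 0 < q)
    (h : p / q ≤ min α (1 - α)) :
    ‖specMean α (a ^ p) (b ^ p)‖ ≤ ‖renyiInner α q a b‖ ^ (p / q) := by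
  rw [le_min_iff, div_le_iff₀ hq, div_le_iff₀ hq] at h
  rcases le_total α (1 / 2) with hα | hα
  · exact norm_specMean_le_of_le_half ha hb hα0 hα hp hq h.1
  · rw [← specMean_swap (ha.rpow a p) (hb.rpow b p), ← norm_renyiInner_swap ha hb]
    exact norm_specMean_le_of_le_half hb ha (by linarith) (by linarith) hp hq h.2

lemma norm_renyiInner_le [Nontrivial 𝒜] {a b : 𝒜} (ha : IsStrictlyPositive a)
    (hb : IsStrictlyPositive b) (hα0 : 0 < α) (hα1 : α < 1) (hp : 0 < p) (hq : 0 < q)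
    (h : max α (1 - α) ≤ p / q) :
    ‖renyiInner α q a b‖ ≤ ‖specMean α (a ^ p) (b ^ p)‖ ^ (q / p) := by
  rw [max_le_iff, le_div_iff₀ hq, le_div_iff₀ hq] at h
  have hα1' : 0 < 1 - α := by linarith
  have hx := ha.rpow a p
  have hy := hb.rpow b p
  set g := invGeoMean (a ^ p) (b ^ p) with hgdef
  have hg : IsStrictlyPositive g := isStrictlyPositive_invGeoMean hx hy
  have hgxg : g * a ^ p * g = b ^ p := invGeoMean_mul_mul_self hx hy.nonneg
  set t := ‖specMean α (a ^ p) (b ^ p)‖ with ht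
  have ht0 : 0 < t := norm_pos_iff.2 (isStrictlyPositive_specMean hx hy α).isUnit.ne_zero
  have h1 : a ^ p ≤ t • g ^ (-α + -α) := le_smul_rpow_of_norm_conj_le hg rpow_nonneg ht.symm.le
  -- Conjugating `h1` by G turns its left side into b^p by the Riccati equation.
  have h2 : b ^ p ≤ t • g ^ (2 * (1 - α)) := by
    have := conj_rpow_le_conj_rpow h1 g 1
    rw [mul_smul_comm, smul_mul_assoc, conj_rpow_rpow hg, rpow_one g hg.nonneg, hgxg] at this
    refine this.trans_eq ?_
    congr 2; ring
  have hbu := le_smul_rpow_of_le ht0 (hg.rpow g _) (u := α * q / p) (by positivity)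
    ((div_le_one hp).2 h.1) h2
  have hau := le_smul_rpow_of_le ht0 (hg.rpow g _) (u := (1 - α) * q / p) (by positivity)
    ((div_le_one hp).2 h.2) h1
  rw [rpow_rpow b _ _ hp.ne', rpow_rpow g _ _ (by positivity)] at hbu
  rw [rpow_rpow a _ _ hp.ne', rpow_rpow g _ _ (by linarith)] at hau
  -- The two bounds become multiples of G^(2s) and G^(-2s) with the same s.
  set s := α * (1 - α) * q / p with hs
  have e1 : 2 * (1 - α) * (α * q / p) = s + s := by rw [hs]; ring
  have e2 : (-α + -α) * ((1 - α) * q / p) = -s + -s := by rw [hs]; ring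
  have e3 : p * (α * q / p) = α * q / 2 + α * q / 2 := by field_simp; ring
  have e4 : p * ((1 - α) * q / p) = (1 - α) / 2 * q + (1 - α) / 2 * q := by field_simp; norm_num
  rw [e1] at hbu
  rw [e2, e4] at hau
  have h5 : renyiInner α q a b =
      a ^ ((1 - α) / 2 * q) * b ^ (α * q / 2 + α * q / 2) * a ^ ((1 - α) / 2 * q) := by
    rw [add_halves, renyiInner]
  rw [h5, norm_rpow_conj_comm ha hb]
  have h6 := conj_rpow_le_conj_rpow hau b (α * q / 2)
  have h7 : ‖b ^ (α * q / 2) * a ^ ((1 - α) / 2 * q + (1 - α) / 2 * q) * b ^ (α * q / 2)‖ ≤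
      t ^ ((1 - α) * q / p) * ‖b ^ (α * q / 2) * g ^ (-s + -s) * b ^ (α * q / 2)‖ := by
    refine (CStarAlgebra.norm_le_norm_of_nonneg_of_le
      ((isSelfAdjoint_rpow b _).conjugate_nonneg rpow_nonneg) h6).trans_eq ?_
    rw [mul_smul_comm, smul_mul_assoc, norm_smul, Real.norm_of_nonneg (by positivity)]
  refine h7.trans ?_
  rw [norm_rpow_conj_comm hb hg, ← e3]
  have h8 : ‖g ^ (-s) * b ^ (p * (α * q / p)) * g ^ (-s)‖ ≤ t ^ (α * q / p) := by
    refine norm_conj_rpow_le hg rpow_nonneg (by positivity) ?_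
    rw [neg_neg]; exact hbu
  calc _ ≤ t ^ ((1 - α) * q / p) * t ^ (α * q / p) := by gcongr
    _ = t ^ (q / p) := by rw [← Real.rpow_add ht0]; congr 1; ring

/-! ### Passing to the limit in the second variable -/

open Filter Topology

/-- Positive powers are continuous up to 0. The second argument of the means occurs only under such
powers, so it may degenerate; the first also occurs under negative ones. -/
lemma tendsto_rpow_of_nonneg {ι : Type*} {l : Filter ι} {f : ι → 𝒜} {b : 𝒜}
    (hf : Tendsto f l (𝓝 b)) (hf0 : ∀ i, 0 ≤ f i) (hb : 0 ≤ b) {r : ℝ} (hr : 0 < r) :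
    Tendsto (fun i => f i ^ r) l (𝓝 (b ^ r)) := by
  lift r to NNReal using hr.le
  have hr' : 0 < r := by exact_mod_cast hr
  have h := (continuousOn_nnrpow (A := 𝒜) r) b hb
  simp_rw [← nnrpow_eq_rpow hr']
  exact h.tendsto.comp (tendsto_nhdsWithin_iff.2 ⟨hf, Eventually.of_forall hf0⟩)

lemma tendsto_specMean {ι : Type*} {l : Filter ι} {f : ι → 𝒜} {x y : 𝒜}
    (hf : Tendsto f l (𝓝 y)) (hf0 : ∀ i, 0 ≤ f i) (hy : 0 ≤ y) (hα0 : 0 < α) :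
    Tendsto (fun i => specMean α x (f i)) l (𝓝 (specMean α x y)) := by
  have key : Tendsto (fun i => invGeoMean x (f i) ^ α) l (𝓝 (invGeoMean x y ^ α)) := by
    refine tendsto_rpow_of_nonneg ?_
      (fun i => (isSelfAdjoint_rpow x _).conjugate_nonneg rpow_nonneg)
      ((isSelfAdjoint_rpow x _).conjugate_nonneg rpow_nonneg) hα0
    refine (tendsto_const_nhds.mul ?_).mul tendsto_const_nhds
    refine tendsto_rpow_of_nonneg ((tendsto_const_nhds.mul hf).mul tendsto_const_nhds)
      (fun i => (isSelfAdjoint_rpow x _).conjugate_nonneg (hf0 i))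
      ((isSelfAdjoint_rpow x _).conjugate_nonneg hy) (by norm_num)
  exact (key.mul tendsto_const_nhds).mul key

/-- A nonnegative element is a limit of the strictly positive elements `b + 1/(n+1)`. -/
lemma exists_tendsto_isStrictlyPositive {b : 𝒜} (hb : 0 ≤ b) :
    ∃ f : ℕ → 𝒜, (∀ n, IsStrictlyPositive (f n)) ∧ Tendsto f atTop (𝓝 b) := by
  refine ⟨fun n => b + (1 / ((n : ℝ) + 1)) • 1, fun n => ?_, ?_⟩
  · refine IsStrictlyPositive.nonneg_add hb ?_
    exact IsStrictlyPositive.smul (by positivity) isStrictlyPositive_one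
  · have := (tendsto_one_div_add_atTop_nhds_zero_nat (𝕜 := ℝ)).smul_const (1 : 𝒜)
    simpa using tendsto_const_nhds.add this

/-- A norm inequality between the two means passes from strictly positive to nonnegative
second arguments. -/
lemma tendsto_norm_specMean_renyiInner {a b : 𝒜} (hb : 0 ≤ b) (hα0 : 0 < α)
    (hp : 0 < p) (hq : 0 < q) :
    ∃ f : ℕ → 𝒜, (∀ n, IsStrictlyPositive (f n)) ∧
      Tendsto (fun n => ‖specMean α (a ^ p) (f n ^ p)‖) atTop
        (𝓝 ‖specMean α (a ^ p) (b ^ p)‖) ∧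
      Tendsto (fun n => ‖renyiInner α q a (f n)‖) atTop (𝓝 ‖renyiInner α q a b‖) := by
  obtain ⟨f, hf, hlim⟩ := exists_tendsto_isStrictlyPositive hb
  refine ⟨f, hf, (tendsto_specMean (tendsto_rpow_of_nonneg hlim (fun n => (hf n).nonneg) hb hp)
    (fun n => rpow_nonneg) rpow_nonneg hα0).norm, ?_⟩
  refine ((tendsto_const_nhds.mul ?_).mul tendsto_const_nhds).norm
  exact tendsto_rpow_of_nonneg hlim (fun n => (hf n).nonneg) hb (mul_pos hα0 hq)

lemma norm_specMean_le_of_nonneg [Nontrivial 𝒜] {a b : 𝒜} (ha : IsStrictlyPositive a)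
    (hb : 0 ≤ b) (hα0 : 0 < α) (hα1 : α < 1) (hp : 0 < p) (hq : 0 < q)
    (h : p / q ≤ min α (1 - α)) :
    ‖specMean α (a ^ p) (b ^ p)‖ ≤ ‖renyiInner α q a b‖ ^ (p / q) := by
  obtain ⟨f, hf, h1, h2⟩ := tendsto_norm_specMean_renyiInner (a := a) hb hα0 hp hq
  exact le_of_tendsto_of_tendsto' h1 (h2.rpow_const (Or.inr (by positivity)))
    fun n => norm_specMean_le ha (hf n) hα0 hα1 hp hq h

lemma norm_renyiInner_le_of_nonneg [Nontrivial 𝒜] {a b : 𝒜} (ha : IsStrictlyPositive a)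
    (hb : 0 ≤ b) (hα0 : 0 < α) (hα1 : α < 1) (hp : 0 < p) (hq : 0 < q)
    (h : max α (1 - α) ≤ p / q) :
    ‖renyiInner α q a b‖ ≤ ‖specMean α (a ^ p) (b ^ p)‖ ^ (q / p) := by
  obtain ⟨f, hf, h1, h2⟩ := tendsto_norm_specMean_renyiInner (a := a) hb hα0 hp hq
  exact le_of_tendsto_of_tendsto' h2 (h1.rpow_const (Or.inr (by positivity)))
    fun n => norm_renyiInner_le ha (hf n) hα0 hα1 hp hq h

end CStar

namespace Matrix

/-! ### Compound matrices. -/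

section Compound

open Set

variable {n : ℕ}

/-- The `k`-th compound matrix: the matrix of the `k`-th exterior power. -/
def compound (k : ℕ) (A : Matrix (Fin n) (Fin n) ℂ) :
    Matrix (powersetCard (Fin n) k) (powersetCard (Fin n) k) ℂ :=
  LinearMap.toMatrix ((Pi.basisFun ℂ (Fin n)).exteriorPower k)
    ((Pi.basisFun ℂ (Fin n)).exteriorPower k) (exteriorPower.map k (Matrix.toLin' A))

variable {k : ℕ}

lemma compound_mul (A B : Matrix (Fin n) (Fin n) ℂ) :
    compound k (A * B) = compound k A * compound k B := by
  rw [compound, Matrix.toLin'_mul, exteriorPower.map_comp, LinearMap.toMatrix_comp _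
    ((Pi.basisFun ℂ (Fin n)).exteriorPower k)]
  rfl

lemma compound_one : compound k (1 : Matrix (Fin n) (Fin n) ℂ) = 1 := by
  rw [compound, Matrix.toLin'_one, exteriorPower.map_id, LinearMap.toMatrix_id]

/-- The entries are the k × k minors. This form gives compatibility with adjoints, whereas
multiplicativity is functoriality of the exterior power. -/
lemma compound_apply (A : Matrix (Fin n) (Fin n) ℂ) (s t : powersetCard (Fin n) k) :
    compound k A s t =
      (A.submatrix (powersetCard.ofFinEmbEquiv.symm s) (powersetCard.ofFinEmbEquiv.symm t)).det := by
  rw [compound, LinearMap.toMatrix_apply, exteriorPower.basis_apply,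
    exteriorPower.basis_repr_apply, exteriorPower.map_apply_ιMulti_family,
    exteriorPower.ιMulti_family, exteriorPower.ιMultiDual_apply_ιMulti, ← Matrix.det_transpose]
  congr 1
  ext i j
  simp

lemma compound_conjTranspose (A : Matrix (Fin n) (Fin n) ℂ) :
    compound k Aᴴ = (compound k A)ᴴ := by
  ext s t
  rw [conjTranspose_apply, compound_apply, compound_apply, ← det_conjTranspose,
    conjTranspose_submatrix]

lemma compound_diagonal (d : Fin n → ℂ) :
    compound k (diagonal d) = diagonal fun s : powersetCard (Fin n) k => ∏ i ∈ s.1, d i := by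
  have hmap : ∀ t : powersetCard (Fin n) k,
      exteriorPower.map k (Matrix.toLin' (diagonal d))
        (exteriorPower.ιMulti_family ℂ k (Pi.basisFun ℂ (Fin n)) t) =
      (∏ i ∈ t.1, d i) • exteriorPower.ιMulti_family ℂ k (Pi.basisFun ℂ (Fin n)) t := by
    intro t
    rw [exteriorPower.map_apply_ιMulti_family, exteriorPower.ιMulti_family,
      exteriorPower.ιMulti_family]
    have : ((Matrix.toLin' (diagonal d)) ∘ (Pi.basisFun ℂ (Fin n))) ∘
        (powersetCard.ofFinEmbEquiv.symm t) = fun j =>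
        d (powersetCard.ofFinEmbEquiv.symm t j) •
          ((Pi.basisFun ℂ (Fin n)) ∘ (powersetCard.ofFinEmbEquiv.symm t)) j := by
      ext j i
      simp only [Function.comp_apply, Matrix.toLin'_apply, mulVec_diagonal, Pi.basisFun_apply,
        Pi.smul_apply, smul_eq_mul, Pi.single_apply]
      split_ifs with h <;> simp [h]
    rw [this, AlternatingMap.map_smul_univ]
    congr 1
    conv_rhs => rw [← Finset.image_orderEmbOfFin_univ t.1 t.2,
      Finset.prod_image (fun _ _ _ _ h => (t.1.orderEmbOfFin t.2).injective h)]
    rfl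
  ext s t
  rw [compound, LinearMap.toMatrix_apply, exteriorPower.basis_apply, hmap, map_smul,
    exteriorPower.basis_repr, Finsupp.smul_apply, Finsupp.single_apply, diagonal_apply]
  by_cases h : s = t
  · subst h; simp
  · simp [h, Ne.symm h]

end Compound

end Matrix

namespace Matrix

/-! ### Functional calculus through unitary diagonalization. -/

section Spectral

variable {ι : Type*} [Fintype ι] [DecidableEq ι]

open Polynomial in
lemma aeval_conj_diagonal (U : unitaryGroup ι ℂ) (d : ι → ℝ) (P : ℝ[X]) :
    aeval ((U : Matrix ι ι ℂ) * diagonal (fun i => (d i : ℂ)) * (U : Matrix ι ι ℂ)ᴴ) P =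
      (U : Matrix ι ι ℂ) * diagonal (fun i => ((P.eval (d i) : ℝ) : ℂ)) *
        (U : Matrix ι ι ℂ)ᴴ := by
  have h := Polynomial.aeval_algHom_apply
    ((Unitary.conjStarAlgAut ℝ (Matrix ι ι ℂ) U).toAlgEquiv.toAlgHom.comp
      (Matrix.diagonalAlgHom (n := ι) (α := ℂ) ℝ)) (fun i => (d i : ℂ)) P
  have h2 : aeval (fun i => (d i : ℂ)) P = fun i => ((P.eval (d i) : ℝ) : ℂ) := by
    ext i
    have := Polynomial.aeval_algHom_apply (Pi.evalAlgHom ℝ (fun _ : ι => ℂ) i)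
      (fun i => (d i : ℂ)) P
    simp only [Pi.evalAlgHom_apply] at this
    rw [← this]
    have := Polynomial.aeval_algebraMap_apply ℂ (d i) P
    simpa using this
  rw [h2] at h
  simpa [star_eq_conjTranspose, Unitary.conjStarAlgAut_apply] using h

lemma cfc_conj_diagonal (U : unitaryGroup ι ℂ) (d : ι → ℝ) (f : ℝ → ℝ) :
    cfc f ((U : Matrix ι ι ℂ) * diagonal (fun i => (d i : ℂ)) * (U : Matrix ι ι ℂ)ᴴ) =
      (U : Matrix ι ι ℂ) * diagonal (fun i => ((f (d i) : ℝ) : ℂ)) *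
        (U : Matrix ι ι ℂ)ᴴ := by
  set A := (U : Matrix ι ι ℂ) * diagonal (fun i => (d i : ℂ)) * (U : Matrix ι ι ℂ)ᴴ with hA
  have hsa : IsSelfAdjoint A := by
    have : IsHermitian (diagonal (fun i => (d i : ℂ))) :=
      isHermitian_diagonal_of_self_adjoint _ (by ext i; simp)
    exact isHermitian_mul_mul_conjTranspose (U : Matrix ι ι ℂ) this
  have hfin : (spectrum ℝ A ∪ Set.range d).Finite :=
    (finite_real_spectrum (A := A)).union (Set.finite_range d)
  -- Interpolating on the spectrum and on the range of `d` together avoids having to identify the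
  -- two sets.
  obtain ⟨P, hP⟩ : ∃ P : Polynomial ℝ, ∀ x ∈ spectrum ℝ A ∪ Set.range d, P.eval x = f x :=
    ⟨Lagrange.interpolate hfin.toFinset id f, fun x hx =>
      Lagrange.eval_interpolate_at_node (v := id) f Function.injective_id.injOn
        (hfin.mem_toFinset.2 hx)⟩
  rw [← cfc_congr (fun x hx => hP x (Or.inl hx)), cfc_polynomial P A, hA,
    aeval_conj_diagonal]
  simp_rw [fun i => hP (d i) (Or.inr ⟨i, rfl⟩)]

lemma conj_diagonal_rpow (U : unitaryGroup ι ℂ) (d : ι → ℝ) (hd : ∀ i, 0 ≤ d i) (r : ℝ) :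
    ((U : Matrix ι ι ℂ) * diagonal (fun i => (d i : ℂ)) * (U : Matrix ι ι ℂ)ᴴ) ^ r =
      (U : Matrix ι ι ℂ) * diagonal (fun i => ((d i ^ r : ℝ) : ℂ)) *
        (U : Matrix ι ι ℂ)ᴴ := by
  have h0 : 0 ≤ (U : Matrix ι ι ℂ) * diagonal (fun i => (d i : ℂ)) * (U : Matrix ι ι ℂ)ᴴ := by
    have : (diagonal (fun i => (d i : ℂ))).PosSemidef :=
      PosSemidef.diagonal (fun i => by simpa using hd i)
    exact (this.mul_mul_conjTranspose_same (U : Matrix ι ι ℂ)).nonneg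
  rw [CFC.rpow_eq_cfc_real h0, cfc_conj_diagonal]

lemma IsHermitian.eq_conj_diagonal {A : Matrix ι ι ℂ} (hA : A.IsHermitian) :
    A = (hA.eigenvectorUnitary : Matrix ι ι ℂ) * diagonal (fun i => (hA.eigenvalues i : ℂ)) *
      (hA.eigenvectorUnitary : Matrix ι ι ℂ)ᴴ := by
  conv_lhs => rw [hA.spectral_theorem]
  simp [star_eq_conjTranspose, Unitary.conjStarAlgAut_apply, Function.comp_def]

lemma PosSemidef.rpow_eq_conj_diagonal {A : Matrix ι ι ℂ} (hA : A.PosSemidef) (r : ℝ) :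
    A ^ r = (hA.isHermitian.eigenvectorUnitary : Matrix ι ι ℂ) *
      diagonal (fun i => ((hA.isHermitian.eigenvalues i ^ r : ℝ) : ℂ)) *
      (hA.isHermitian.eigenvectorUnitary : Matrix ι ι ℂ)ᴴ := by
  rw [← conj_diagonal_rpow _ _ hA.eigenvalues_nonneg, ← hA.isHermitian.eq_conj_diagonal]

lemma PosSemidef.det_rpow {A : Matrix ι ι ℂ} (hA : A.PosSemidef) (r : ℝ) :
    (A ^ r).det = ((A.det.re ^ r : ℝ) : ℂ) := by
  rw [hA.rpow_eq_conj_diagonal, hA.isHermitian.det_eq_prod_eigenvalues, det_mul_right_comm,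
    ← star_eq_conjTranspose, Unitary.mul_star_self_of_mem (SetLike.coe_mem _), one_mul,
    det_diagonal]
  have : (∏ i, (hA.isHermitian.eigenvalues i : ℂ)).re = ∏ i, hA.isHermitian.eigenvalues i := by
    rw [← Complex.ofReal_prod, Complex.ofReal_re]
  simp only [Complex.coe_algebraMap] at *
  rw [this, ← Complex.ofReal_prod, Real.finsetProd_rpow _ _ fun i _ => hA.eigenvalues_nonneg i]

end Spectral

/-! ### Compounds, eigenvalue products and log-majorization. -/

section CompoundSpectral

open Set

variable {n k : ℕ}

/-- The compound of a unitary matrix. -/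
def compoundUnitary (k : ℕ) (U : unitaryGroup (Fin n) ℂ) :
    unitaryGroup (powersetCard (Fin n) k) ℂ :=
  ⟨compound k (U : Matrix (Fin n) (Fin n) ℂ), by
    rw [mem_unitaryGroup_iff, star_eq_conjTranspose, ← compound_conjTranspose, ← compound_mul,
      ← star_eq_conjTranspose, Unitary.mul_star_self_of_mem U.2, compound_one]⟩

lemma compound_conj_diagonal (U : unitaryGroup (Fin n) ℂ) (d : Fin n → ℝ) :
    compound k ((U : Matrix (Fin n) (Fin n) ℂ) * diagonal (fun i => (d i : ℂ)) *
      (U : Matrix (Fin n) (Fin n) ℂ)ᴴ) =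
    (compoundUnitary k U : Matrix (powersetCard (Fin n) k) (powersetCard (Fin n) k) ℂ) *
      diagonal (fun s : powersetCard (Fin n) k => ((∏ i ∈ s.1, d i : ℝ) : ℂ)) *
      (compoundUnitary k U : Matrix (powersetCard (Fin n) k) (powersetCard (Fin n) k) ℂ)ᴴ := by
  rw [compound_mul, compound_mul, compound_diagonal, compound_conjTranspose]
  simp [compoundUnitary]

lemma PosSemidef.compound_rpow {A : Matrix (Fin n) (Fin n) ℂ} (hA : A.PosSemidef) (r : ℝ) :
    compound k (A ^ r) = compound k A ^ r := by
  conv_rhs => rw [hA.isHermitian.eq_conj_diagonal, compound_conj_diagonal,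
    conj_diagonal_rpow _ _ fun s => Finset.prod_nonneg fun i _ => hA.eigenvalues_nonneg i]
  rw [hA.rpow_eq_conj_diagonal, compound_conj_diagonal]
  congr! 5
  exact Real.finsetProd_rpow _ _ (fun i _ => hA.eigenvalues_nonneg i) r

lemma PosSemidef.compound {A : Matrix (Fin n) (Fin n) ℂ} (hA : A.PosSemidef) :
    (compound k A).PosSemidef := by
  rw [hA.isHermitian.eq_conj_diagonal, compound_conj_diagonal]
  refine PosSemidef.mul_mul_conjTranspose_same (PosSemidef.diagonal fun s => ?_) _
  exact Complex.zero_le_real.2 (Finset.prod_nonneg fun i _ => hA.eigenvalues_nonneg i)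

lemma PosDef.compound {A : Matrix (Fin n) (Fin n) ℂ} (hA : A.PosDef) :
    (compound k A).PosDef := by
  rw [hA.posSemidef.compound.posDef_iff_isUnit]
  obtain ⟨u, rfl⟩ := hA.isUnit
  refine IsUnit.of_mul_eq_one (Matrix.compound k (↑u⁻¹ : Matrix (Fin n) (Fin n) ℂ)) ?_
  rw [← compound_mul, u.mul_inv, compound_one]

lemma prod_le_prod_initial {m : ℕ} {f : Fin m → ℝ} (hf : Antitone f) (hf0 : ∀ i, 0 ≤ f i)
    (T : Finset (Fin m)) : ∏ i ∈ T, f i ≤ ∏ i with i.val < T.card, f i := by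
  have hle : T.card ≤ m := by simpa using T.card_le_univ
  have hidx : ∀ j : Fin T.card, Fin.castLE hle j ≤ T.orderEmbOfFin rfl j := by
    intro j
    -- The j-th element of T has j elements of T below it, hence is at least j.
    have := Finset.card_le_card_of_injOn (s := Finset.Iio j)
      (t := Finset.Iio (T.orderEmbOfFin rfl j)) (T.orderEmbOfFin rfl)
      (fun i hi => by simpa using hi) (T.orderEmbOfFin rfl).injective.injOn
    simpa [Fin.le_def] using this
  have h1 : ∏ i ∈ T, f i = ∏ j : Fin T.card, f (T.orderEmbOfFin rfl j) := by
    conv_lhs => rw [← Finset.image_orderEmbOfFin_univ T rfl,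
      Finset.prod_image (fun _ _ _ _ h => (T.orderEmbOfFin rfl).injective h)]
  have h2 : ∏ i with i.val < T.card, f i = ∏ j : Fin T.card, f (Fin.castLE hle j) := by
    have : Finset.univ.filter (fun i : Fin m => i.val < T.card) =
        Finset.univ.image (Fin.castLE hle) := by
      ext i
      simp only [Finset.mem_filter, Finset.mem_univ, true_and, Finset.mem_image]
      exact ⟨fun h => ⟨⟨i, h⟩, rfl⟩, fun ⟨j, hj⟩ => hj ▸ j.2⟩
    rw [this, Finset.prod_image fun _ _ _ _ h => Fin.castLE_injective hle h]
  rw [h1, h2]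
  exact Finset.prod_le_prod (fun _ _ => hf0 _) fun j _ => hf (hidx j)

open scoped Matrix.Norms.L2Operator

lemma norm_conj_diagonal {ι : Type*} [Fintype ι] [DecidableEq ι] (U : unitaryGroup ι ℂ)
    (d : ι → ℂ) :
    ‖(U : Matrix ι ι ℂ) * diagonal d * (U : Matrix ι ι ℂ)ᴴ‖ = ‖d‖ := by
  rw [← star_eq_conjTranspose, ← Unitary.coe_star, CStarRing.norm_mul_coe_unitary,
    CStarRing.norm_coe_unitary_mul, l2_opNorm_diagonal]

/-- The operator norm of the `k`-th compound is the product of the `k` largest eigenvalues. -/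
lemma PosSemidef.norm_compound {A : Matrix (Fin n) (Fin n) ℂ} (hA : A.PosSemidef) (hk : k ≤ n) :
    ‖Matrix.compound k A‖ = ∏ i with i.val < k, hA.isHermitian.eigenvalues₀ i := by
  have h0 : ∀ i, 0 ≤ hA.isHermitian.eigenvalues₀ i := by
    intro i
    have := hA.eigenvalues_nonneg (Fintype.equivOfCardEq (Fintype.card_fin _) i)
    simpa [IsHermitian.eigenvalues] using this
  set e : Fin (Fintype.card (Fin n)) ≃ Fin n := Fintype.equivOfCardEq (Fintype.card_fin _) with he
  have hev : ∀ i, hA.isHermitian.eigenvalues i = hA.isHermitian.eigenvalues₀ (e.symm i) :=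
    fun i => rfl
  conv_lhs => rw [hA.isHermitian.eq_conj_diagonal, compound_conj_diagonal, norm_conj_diagonal]
  have hprod : ∀ s : Finset (Fin n), ∏ i ∈ s, hA.isHermitian.eigenvalues i =
      ∏ i ∈ s.map e.symm.toEmbedding, hA.isHermitian.eigenvalues₀ i := by
    intro s; simp [Finset.prod_map, hev]
  have hn : ∀ s : Finset (Fin n), ‖((∏ i ∈ s, hA.isHermitian.eigenvalues i : ℝ) : ℂ)‖ =
      ∏ i ∈ s, hA.isHermitian.eigenvalues i := fun s => by
    rw [Complex.norm_real, Real.norm_of_nonneg]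
    exact Finset.prod_nonneg fun i _ => hA.eigenvalues_nonneg i
  apply le_antisymm
  · refine (pi_norm_le_iff_of_nonneg (Finset.prod_nonneg fun i _ => h0 i)).2 fun s => ?_
    rw [hn, hprod]
    have := prod_le_prod_initial hA.isHermitian.eigenvalues₀_antitone h0
      (s.1.map e.symm.toEmbedding)
    rwa [Finset.card_map, s.2] at this
  -- The positions of the k largest eigenvalues, carried by `e` to the indexing of `eigenvalues`;
  -- they attain the maximum.
  · let s₀ : Finset (Fin n) :=
      (Finset.univ.filter fun i : Fin (Fintype.card (Fin n)) => i.val < k).map e.toEmbedding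
    have hs₀ : s₀.card = k := by
      rw [Finset.card_map, Fin.card_filter_val_lt, Fintype.card_fin, min_eq_right hk]
    have h1 := norm_le_pi_norm (fun s : powersetCard (Fin n) k =>
      ((∏ i ∈ s.1, hA.isHermitian.eigenvalues i : ℝ) : ℂ)) ⟨s₀, hs₀⟩
    rw [hn, hprod, Finset.map_map] at h1
    simpa [s₀, Finset.map_map] using h1

lemma logMaj_of_norm_compound_le {X Y : Matrix (Fin n) (Fin n) ℂ} (hX : X.PosSemidef)
    (hY : Y.PosSemidef)
    (h : ∀ k, 1 ≤ k → k ≤ n → ‖Matrix.compound k X‖ ≤ ‖Matrix.compound k Y‖)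
    (hdet : X.det = Y.det) : LogMaj X Y := by
  refine ⟨hX, hY, fun k hk hkn => ?_, ?_⟩
  · rw [← hX.norm_compound hkn, ← hY.norm_compound hkn]
    exact h k hk hkn
  · have key : ∀ {Z : Matrix (Fin n) (Fin n) ℂ} (hZ : Z.IsHermitian),
        Z.det = ((∏ i, hZ.eigenvalues₀ i : ℝ) : ℂ) := by
      intro Z hZ
      rw [hZ.det_eq_prod_eigenvalues, Complex.ofReal_prod]
      exact Equiv.prod_comp (Fintype.equivOfCardEq (Fintype.card_fin _)).symm
        fun i => (hZ.eigenvalues₀ i : ℂ)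
    rw [key hX.isHermitian, key hY.isHermitian] at hdet
    exact_mod_cast hdet

lemma PosSemidef.norm_eq_eigenvalues₀ [NeZero n] {A : Matrix (Fin n) (Fin n) ℂ}
    (hA : A.PosSemidef) :
    ‖A‖ = ∏ i with i.val < 1, hA.isHermitian.eigenvalues₀ i := by
  have hcard : 0 < Fintype.card (Fin n) := by simpa using NeZero.pos n
  have hfilter : Finset.univ.filter (fun i : Fin (Fintype.card (Fin n)) => i.val < 1) =
      {⟨0, hcard⟩} := by
    ext i
    rw [Finset.mem_filter, Finset.mem_singleton, Fin.ext_iff]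
    simp only [Finset.mem_univ, true_and]
    omega
  rw [hfilter, Finset.prod_singleton]
  conv_lhs => rw [hA.isHermitian.eq_conj_diagonal, norm_conj_diagonal]
  have hn : ∀ i, ‖((hA.isHermitian.eigenvalues i : ℝ) : ℂ)‖ = hA.isHermitian.eigenvalues i :=
    fun i => by rw [Complex.norm_real, Real.norm_of_nonneg (hA.eigenvalues_nonneg i)]
  set e : Fin (Fintype.card (Fin n)) ≃ Fin n := Fintype.equivOfCardEq (Fintype.card_fin _) with he
  have hev : ∀ i, hA.isHermitian.eigenvalues i = hA.isHermitian.eigenvalues₀ (e.symm i) :=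
    fun i => rfl
  apply le_antisymm
  · refine (pi_norm_le_iff_of_nonempty _).2 fun i => ?_
    rw [hn, hev]
    exact hA.isHermitian.eigenvalues₀_antitone (Nat.zero_le _)
  · have h := norm_le_pi_norm (fun i => ((hA.isHermitian.eigenvalues i : ℝ) : ℂ)) (e ⟨0, hcard⟩)
    rwa [hn, hev, e.symm_apply_apply] at h

end CompoundSpectral

end Matrix

open scoped Matrix.Norms.L2Operator in
lemma LogMaj.norm_le {n : ℕ} [NeZero n] {X Y : Matrix (Fin n) (Fin n) ℂ} (h : LogMaj X Y) :
    ‖X‖ ≤ ‖Y‖ := by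
  obtain ⟨hX, hY, h, -⟩ := h
  rw [hX.norm_eq_eigenvalues₀, hY.norm_eq_eigenvalues₀]
  exact h 1 le_rfl (NeZero.pos n)

namespace Matrix

/-! ### Powers and supports of singular matrices. -/

section Powers

variable {n : ℕ} {A B : Matrix (Fin n) (Fin n) ℂ}

/-- Every function is continuous on the finite spectrum of a matrix. -/
lemma continuousOn_spectrum (A : Matrix (Fin n) (Fin n) ℂ) (f : ℝ → ℝ) :
    ContinuousOn f (spectrum ℝ A) :=
  (finite_real_spectrum (A := A)).continuousOn f

lemma PosSemidef.rpow_eq_cfc (hA : A.PosSemidef) (r : ℝ) :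
    A ^ r = cfc (fun x : ℝ => x ^ r) A := CFC.rpow_eq_cfc_real hA.nonneg

/-- On a finite spectrum every power function is continuous, so singular matrices and negative
exponents (generalized inverses) are covered. -/
lemma PosSemidef.rpow_rpow (hA : A.PosSemidef) (r s : ℝ) : (A ^ r) ^ s = A ^ (r * s) := by
  have hr : (A ^ r).PosSemidef := nonneg_iff_posSemidef.1 CFC.rpow_nonneg
  have hsa : IsSelfAdjoint A := hA.isHermitian
  rw [hr.rpow_eq_cfc, hA.rpow_eq_cfc, hA.rpow_eq_cfc,
    ← cfc_comp (fun x : ℝ => x ^ s) (fun x : ℝ => x ^ r) A hsa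
      (((finite_real_spectrum (A := A)).image _).continuousOn _) (continuousOn_spectrum A _)]
  refine cfc_congr fun x hx => ?_
  exact (Real.rpow_mul (spectrum_nonneg_of_nonneg hA.nonneg hx) r s).symm

lemma PosSemidef.rpow_add (hA : A.PosSemidef) {r s : ℝ} (h : r + s ≠ 0) :
    A ^ (r + s) = A ^ r * A ^ s := by
  rw [hA.rpow_eq_cfc, hA.rpow_eq_cfc, hA.rpow_eq_cfc,
    ← cfc_mul _ _ A (continuousOn_spectrum A _) (continuousOn_spectrum A _)]
  exact cfc_congr fun x hx => Real.rpow_add' (spectrum_nonneg_of_nonneg hA.nonneg hx) h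

/-- If `P A = A = A P` then the same holds for the powers of `A`. -/
lemma PosSemidef.rpow_absorb (hA : A.PosSemidef) {P : Matrix (Fin n) (Fin n) ℂ}
    (h1 : P * A = A) (h2 : A * P = A) {r : ℝ} (hr : r ≠ 0) :
    P * A ^ r = A ^ r ∧ A ^ r * P = A ^ r := by
  constructor
  · have h := hA.rpow_add (r := 1) (s := r - 1) (by simpa using hr)
    rw [add_sub_cancel, CFC.rpow_one A hA.nonneg] at h
    rw [h, ← mul_assoc, h1]
  · have h := hA.rpow_add (r := r - 1) (s := 1) (by simpa using hr)
    rw [sub_add_cancel, CFC.rpow_one A hA.nonneg] at h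
    rw [h, mul_assoc, h2]

end Powers

section Support

open scoped Matrix.Norms.L2Operator

variable {n : ℕ} {A B : Matrix (Fin n) (Fin n) ℂ}

/-- `A + (1 - s(A))`, the positive definite matrix that agrees with `A` on its support. -/
def fillKer (A : Matrix (Fin n) (Fin n) ℂ) : Matrix (Fin n) (Fin n) ℂ :=
  cfc (fun x : ℝ => if x = 0 then 1 else x) A

lemma PosSemidef.posDef_fillKer (hA : A.PosSemidef) : (fillKer A).PosDef := by
  have hsa : IsSelfAdjoint A := hA.isHermitian
  have h0 : 0 ≤ fillKer A := cfc_nonneg fun x hx => by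
    have := spectrum_nonneg_of_nonneg hA.nonneg hx
    split_ifs <;> linarith
  rw [(nonneg_iff_posSemidef.1 h0).posDef_iff_isUnit, fillKer,
    isUnit_cfc_iff _ A (continuousOn_spectrum A _)]
  intro x _
  split_ifs with h
  · exact one_ne_zero
  · exact h

lemma isStarProjection_supportProj (hA : A.PosSemidef) : IsStarProjection (supportProj A) := by
  have hsa : IsSelfAdjoint A := hA.isHermitian
  refine ⟨?_, cfc_predicate _ _⟩
  rw [IsIdempotentElem, supportProj,
    ← cfc_mul _ _ A (continuousOn_spectrum A _) (continuousOn_spectrum A _)]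
  exact cfc_congr fun x _ => by by_cases h : x = 0 <;> simp [h]

lemma supportProj_mul_self (hA : A.PosSemidef) : supportProj A * A = A := by
  have hsa : IsSelfAdjoint A := hA.isHermitian
  nth_rw 2 [← cfc_id ℝ A]
  rw [supportProj, ← cfc_mul _ _ A (continuousOn_spectrum A _) (continuousOn_spectrum A _)]
  conv_rhs => rw [← cfc_id ℝ A]
  exact cfc_congr fun x _ => by by_cases h : x = 0 <;> simp [h]

/-- On the kernel of A both sides vanish: 1 · 0 = 0 = 0^r as r ≠ 0. -/
lemma fillKer_rpow_mul_supportProj (hA : A.PosSemidef) {r : ℝ} (hr : r ≠ 0) :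
    fillKer A ^ r * supportProj A = A ^ r ∧ supportProj A * fillKer A ^ r = A ^ r := by
  have hsa : IsSelfAdjoint A := hA.isHermitian
  have h1 : fillKer A ^ r = cfc (fun x : ℝ => (if x = 0 then 1 else x) ^ r) A := by
    rw [hA.posDef_fillKer.posSemidef.rpow_eq_cfc, fillKer,
      ← cfc_comp (fun x : ℝ => x ^ r) _ A hsa
        (((finite_real_spectrum (A := A)).image _).continuousOn _) (continuousOn_spectrum A _)]
    rfl
  rw [h1, supportProj, hA.rpow_eq_cfc,
    ← cfc_mul _ _ A (continuousOn_spectrum A _) (continuousOn_spectrum A _),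
    ← cfc_mul _ _ A (continuousOn_spectrum A _) (continuousOn_spectrum A _)]
  constructor <;>
  exact cfc_congr fun x _ => by by_cases h : x = 0 <;> simp [h, hr]

lemma supportProj_mul_of_le (hA : A.PosSemidef) (hB : B.PosSemidef)
    (h : supportProj B ≤ supportProj A) : supportProj A * B = B ∧ B * supportProj A = B := by
  have h1 := ((isStarProjection_supportProj hA).mul_right_and_mul_left_of_nonneg_of_le
    (isStarProjection_supportProj hB).nonneg h).2
  have h2 : supportProj A * B = B := by
    nth_rw 1 [← supportProj_mul_self hB]
    rw [← mul_assoc, h1, supportProj_mul_self hB]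
  refine ⟨h2, ?_⟩
  have h3 := congrArg star h2
  have hB' : IsSelfAdjoint B := hB.isHermitian
  rwa [star_mul, hB'.star_eq, (isStarProjection_supportProj hA).isSelfAdjoint.star_eq] at h3

lemma supportProj_mul_rpow_of_le (hA : A.PosSemidef) (hB : B.PosSemidef)
    (h : supportProj B ≤ supportProj A) {r : ℝ} (hr : r ≠ 0) :
    supportProj A * B ^ r = B ^ r ∧ B ^ r * supportProj A = B ^ r := by
  obtain ⟨h1, h2⟩ := supportProj_mul_of_le hA hB h
  exact hB.rpow_absorb h1 h2 hr

variable {α p q : ℝ}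

lemma renyiMean_fillKer (hA : A.PosSemidef) (hB : B.PosSemidef)
    (h : supportProj B ≤ supportProj A) (hα0 : 0 < α) (hα1 : α < 1) (hq : 0 < q) :
    renyiMean α q (fillKer A) B = renyiMean α q A B := by
  have hr0 : (1 - α) / 2 * q ≠ 0 := (mul_pos (by linarith) hq).ne'
  obtain ⟨f1, f2⟩ := fillKer_rpow_mul_supportProj hA hr0
  obtain ⟨hl, hr⟩ := supportProj_mul_rpow_of_le hA hB h (r := α * q) (by positivity)
  unfold renyiMean
  congr 1
  calc _ = fillKer A ^ ((1 - α) / 2 * q) * (supportProj A * B ^ (α * q) * supportProj A) *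
        fillKer A ^ ((1 - α) / 2 * q) := by rw [hl, hr]
    _ = fillKer A ^ ((1 - α) / 2 * q) * supportProj A * B ^ (α * q) *
        (supportProj A * fillKer A ^ ((1 - α) / 2 * q)) := by simp only [mul_assoc]
    _ = _ := by rw [f1, f2]

lemma geoMean_half_rpow_neg_one (hA : A.PosSemidef) (B : Matrix (Fin n) (Fin n) ℂ) :
    geoMean (1 / 2) (A ^ (-1 : ℝ)) B = invGeoMean A B := by
  unfold geoMean invGeoMean
  simp only [hA.rpow_rpow]
  norm_num

lemma SG_eq_specMean_rpow (A B : Matrix (Fin n) (Fin n) ℂ) :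
    SG α p A B = specMean α (A ^ p) (B ^ p) ^ (1 / p) := by
  rw [SG, spectralGeoMean, geoMean_half_rpow_neg_one (nonneg_iff_posSemidef.1 CFC.rpow_nonneg)]
  rfl

lemma renyiMean_eq_renyiInner_rpow (A B : Matrix (Fin n) (Fin n) ℂ) :
    renyiMean α q A B = renyiInner α q A B ^ (1 / q) := rfl

/-- Every factor placed between powers of `fillKer A` is absorbed by P = s(A), starting with B^p,
and P cuts those powers down to powers of A. The outer factor A^p is recovered from the P absorbed
by the power of the geometric mean. -/
lemma SG_fillKer (hA : A.PosSemidef) (hB : B.PosSemidef)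
    (h : supportProj B ≤ supportProj A) (hα0 : 0 < α) (hp : 0 < p) :
    SG α p (fillKer A) B = SG α p A B := by
  rw [SG_eq_specMean_rpow, SG_eq_specMean_rpow]
  congr 1
  obtain ⟨hl, hr⟩ := supportProj_mul_rpow_of_le hA hB h hp.ne'
  set P := supportProj A
  set x := A ^ p with hx
  set x' := fillKer A ^ p with hx'
  set y := B ^ p
  have hpow : ∀ s : ℝ, s ≠ 0 → x' ^ s * P = x ^ s ∧ P * x' ^ s = x ^ s := fun s hs => by
    rw [hx, hx', hA.rpow_rpow, hA.posDef_fillKer.posSemidef.rpow_rpow]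
    exact fillKer_rpow_mul_supportProj hA (mul_ne_zero hp.ne' hs)
  have conj : ∀ (s : ℝ) (z : Matrix (Fin n) (Fin n) ℂ), s ≠ 0 → P * z = z → z * P = z →
      x' ^ s * z * x' ^ s = x ^ s * z * x ^ s := fun s z hs h1 h2 => by
    obtain ⟨f1, f2⟩ := hpow s hs
    calc _ = x' ^ s * (P * z * P) * x' ^ s := by rw [h1, h2]
      _ = x' ^ s * P * z * (P * x' ^ s) := by simp only [mul_assoc]
      _ = _ := by rw [f1, f2]
  have hPP : P * P = P := (isStarProjection_supportProj hA).isIdempotentElem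
  have absorb : ∀ s : ℝ, s ≠ 0 → P * x ^ s = x ^ s ∧ x ^ s * P = x ^ s := fun s hs => by
    obtain ⟨f1, f2⟩ := hpow s hs
    constructor
    · rw [← f2, ← mul_assoc, hPP]
    · rw [← f1, mul_assoc, hPP]
  have absorb_conj : ∀ (s : ℝ) (z : Matrix (Fin n) (Fin n) ℂ), s ≠ 0 →
      P * (x ^ s * z * x ^ s) = x ^ s * z * x ^ s ∧
      (x ^ s * z * x ^ s) * P = x ^ s * z * x ^ s := fun s z hs => by
    obtain ⟨f1, f2⟩ := absorb s hs
    constructor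
    · rw [← mul_assoc, ← mul_assoc, f1]
    · rw [mul_assoc, f2]
  have hhalf : (1 / 2 : ℝ) ≠ 0 := by norm_num
  have hnhalf : (-(1 / 2) : ℝ) ≠ 0 := by norm_num
  have hG : invGeoMean x' y = invGeoMean x y := by
    unfold invGeoMean
    obtain ⟨h1, h2⟩ := absorb_conj (1 / 2) y hhalf
    obtain ⟨h3, h4⟩ := (nonneg_iff_posSemidef.1
      ((isSelfAdjoint_rpow x (1 / 2)).conjugate_nonneg CFC.rpow_nonneg)).rpow_absorb h1 h2 hhalf
    rw [conj _ _ hhalf hl hr, conj _ _ hnhalf h3 h4]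
  obtain ⟨h1, h2⟩ := absorb_conj (-(1 / 2))
    ((x ^ (1 / 2 : ℝ) * y * x ^ (1 / 2 : ℝ)) ^ (1 / 2 : ℝ)) hnhalf
  obtain ⟨h3, h4⟩ := PosSemidef.rpow_absorb (A := invGeoMean x y) (nonneg_iff_posSemidef.1
    ((isSelfAdjoint_rpow x _).conjugate_nonneg CFC.rpow_nonneg)) h1 h2 hα0.ne'
  have hxP : x' * P = x := by
    have := (hpow 1 one_ne_zero).1
    rwa [CFC.rpow_one x' CFC.rpow_nonneg, CFC.rpow_one x CFC.rpow_nonneg] at this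
  unfold specMean
  rw [hG]
  calc _ = invGeoMean x y ^ α * x' * (P * invGeoMean x y ^ α) := by rw [h3]
    _ = invGeoMean x y ^ α * (x' * P) * invGeoMean x y ^ α := by simp only [mul_assoc]
    _ = _ := by rw [hxP]

end Support
end Matrix

namespace Matrix

open scoped Matrix.Norms.L2Operator

variable {α p q : ℝ}

/-! ### From norm inequalities to log-majorization. -/

section Sufficiency

variable {n k : ℕ} {A B : Matrix (Fin n) (Fin n) ℂ}

lemma compound_specMean {X Y : Matrix (Fin n) (Fin n) ℂ} (hX : X.PosSemidef)
    (hY : Y.PosSemidef) :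
    compound k (specMean α X Y) = specMean α (compound k X) (compound k Y) := by
  have h1 : (X ^ (1 / 2 : ℝ) * Y * X ^ (1 / 2 : ℝ)).PosSemidef :=
    nonneg_iff_posSemidef.1 ((isSelfAdjoint_rpow X _).conjugate_nonneg hY.nonneg)
  have h2 : (invGeoMean X Y).PosSemidef :=
    nonneg_iff_posSemidef.1 ((isSelfAdjoint_rpow X _).conjugate_nonneg CFC.rpow_nonneg)
  have h3 : compound k (invGeoMean X Y) = invGeoMean (compound k X) (compound k Y) := by
    simp only [invGeoMean, compound_mul, h1.compound_rpow, hX.compound_rpow]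
  simp only [specMean, compound_mul, h2.compound_rpow, h3]

lemma compound_SG (hA : A.PosSemidef) (hB : B.PosSemidef) :
    compound k (SG α p A B) =
      specMean α (compound k A ^ p) (compound k B ^ p) ^ (1 / p) := by
  have hAp : (A ^ p).PosSemidef := nonneg_iff_posSemidef.1 CFC.rpow_nonneg
  have hBp : (B ^ p).PosSemidef := nonneg_iff_posSemidef.1 CFC.rpow_nonneg
  have h : (specMean α (A ^ p) (B ^ p)).PosSemidef :=
    nonneg_iff_posSemidef.1 (specMean_nonneg α hAp.nonneg _)
  rw [SG_eq_specMean_rpow, h.compound_rpow, compound_specMean hAp hBp, hA.compound_rpow,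
    hB.compound_rpow]

lemma compound_renyiMean (hA : A.PosSemidef) (hB : B.PosSemidef) :
    compound k (renyiMean α q A B) =
      renyiInner α q (compound k A) (compound k B) ^ (1 / q) := by
  have h : (renyiInner α q A B).PosSemidef := nonneg_iff_posSemidef.1 (renyiInner_nonneg α q A B)
  rw [renyiMean_eq_renyiInner_rpow, h.compound_rpow]
  simp only [renyiInner, compound_mul, hA.compound_rpow, hB.compound_rpow]

lemma PosSemidef.det_rpow_of_eq (hA : A.PosSemidef) {m : ℝ} (h : A.det = m) (r : ℝ) :
    (A ^ r).det = ((m ^ r : ℝ) : ℂ) := by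
  rw [hA.det_rpow, h, Complex.ofReal_re]

lemma det_renyiMean (hA : A.PosSemidef) (hB : B.PosSemidef) {a b : ℝ} (ha : A.det = a)
    (hb : B.det = b) (ha0 : 0 < a) (hb0 : 0 ≤ b) (hq : 0 < q) :
    (renyiMean α q A B).det = ((a ^ (1 - α) * b ^ α : ℝ) : ℂ) := by
  have h : (renyiInner α q A B).PosSemidef := nonneg_iff_posSemidef.1 (renyiInner_nonneg α q A B)
  rw [renyiMean_eq_renyiInner_rpow, h.det_rpow_of_eq (m := a ^ ((1 - α) * q) * b ^ (α * q))]
  · rw [Real.mul_rpow (by positivity) (by positivity), ← Real.rpow_mul ha0.le,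
      ← Real.rpow_mul hb0]
    congr 3 <;> field_simp
  · rw [renyiInner, det_mul, det_mul, hA.det_rpow_of_eq ha, hB.det_rpow_of_eq hb,
      ← Complex.ofReal_mul, ← Complex.ofReal_mul, mul_right_comm, ← Real.rpow_add ha0]
    congr 3; ring

lemma det_SG (hA : A.PosSemidef) (hB : B.PosSemidef) {a b : ℝ} (ha : A.det = a)
    (hb : B.det = b) (ha0 : 0 < a) (hb0 : 0 ≤ b) (hp : 0 < p) (hα0 : 0 < α) :
    (SG α p A B).det = ((a ^ (1 - α) * b ^ α : ℝ) : ℂ) := by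
  have hX : (A ^ p).PosSemidef := nonneg_iff_posSemidef.1 CFC.rpow_nonneg
  have hY : (B ^ p).PosSemidef := nonneg_iff_posSemidef.1 CFC.rpow_nonneg
  have hx : (A ^ p).det = ((a ^ p : ℝ) : ℂ) := hA.det_rpow_of_eq ha p
  have hy : (B ^ p).det = ((b ^ p : ℝ) : ℂ) := hB.det_rpow_of_eq hb p
  set X := A ^ p
  set Y := B ^ p
  set x := a ^ p with hxdef
  set y := b ^ p with hydef
  have hx0 : 0 < x := by positivity
  have hy0 : 0 ≤ y := by positivity
  have h1 : (X ^ (1 / 2 : ℝ) * Y * X ^ (1 / 2 : ℝ)).PosSemidef :=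
    nonneg_iff_posSemidef.1 ((isSelfAdjoint_rpow X _).conjugate_nonneg hY.nonneg)
  have h2 : (invGeoMean X Y).PosSemidef :=
    nonneg_iff_posSemidef.1 ((isSelfAdjoint_rpow X _).conjugate_nonneg CFC.rpow_nonneg)
  have h3 : (specMean α X Y).PosSemidef := nonneg_iff_posSemidef.1 (specMean_nonneg α hX.nonneg _)
  have d1 : (X ^ (1 / 2 : ℝ) * Y * X ^ (1 / 2 : ℝ)).det = ((x * y : ℝ) : ℂ) := by
    rw [det_mul, det_mul, hX.det_rpow_of_eq hx, hy, ← Complex.ofReal_mul, ← Complex.ofReal_mul,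
      mul_right_comm, ← Real.rpow_add hx0]
    norm_num
  have d2 : (invGeoMean X Y).det = ((x ^ (-(1 / 2) : ℝ) * y ^ (1 / 2 : ℝ) : ℝ) : ℂ) := by
    rw [invGeoMean, det_mul, det_mul, hX.det_rpow_of_eq hx, h1.det_rpow_of_eq d1,
      ← Complex.ofReal_mul, ← Complex.ofReal_mul, Real.mul_rpow hx0.le hy0]
    congr 1
    calc _ = x ^ (-(1 / 2) : ℝ) * x ^ (1 / 2 : ℝ) * x ^ (-(1 / 2) : ℝ) * y ^ (1 / 2 : ℝ) := by ring
      _ = _ := by rw [← Real.rpow_add hx0, ← Real.rpow_add hx0]; norm_num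
  have d3 : (specMean α X Y).det = ((x ^ (1 - α) * y ^ α : ℝ) : ℂ) := by
    rw [specMean, det_mul, det_mul, h2.det_rpow_of_eq d2, hx, ← Complex.ofReal_mul,
      ← Complex.ofReal_mul, Real.mul_rpow (by positivity) (by positivity), ← Real.rpow_mul hx0.le,
      ← Real.rpow_mul hy0]
    congr 1
    calc _ = (x ^ (-(1 / 2) * α) * x ^ (1 : ℝ) * x ^ (-(1 / 2) * α)) *
          (y ^ (1 / 2 * α) * y ^ (1 / 2 * α)) := by rw [Real.rpow_one]; ring
      _ = _ := by
        rw [← Real.rpow_add hx0, ← Real.rpow_add hx0,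
          ← Real.rpow_add_of_nonneg hy0 (by positivity) (by positivity)]
        congr 2 <;> ring
  rw [SG_eq_specMean_rpow, h3.det_rpow_of_eq d3, Real.mul_rpow (by positivity) (by positivity),
    hxdef, hydef, ← Real.rpow_mul ha0.le, ← Real.rpow_mul ha0.le, ← Real.rpow_mul hb0,
    ← Real.rpow_mul hb0]
  congr 3 <;> field_simp

lemma det_SG_eq_det_renyiMean (hA : A.PosDef) (hB : B.PosSemidef) (hα0 : 0 < α) (hp : 0 < p)
    (hq : 0 < q) : (SG α p A B).det = (renyiMean α q A B).det := by
  obtain ⟨a, ha0, ha⟩ := RCLike.pos_iff_exists_ofReal.1 hA.det_pos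
  obtain ⟨b, hb0, hb⟩ := RCLike.nonneg_iff_exists_ofReal.1 hB.det_nonneg
  rw [det_SG hA.posSemidef hB ha.symm hb.symm ha0 hb0 hp hα0,
    det_renyiMean hA.posSemidef hB ha.symm hb.symm ha0 hb0 hq]

lemma nontrivial_compound (hk : k ≤ n) :
    Nontrivial (Matrix (Set.powersetCard (Fin n) k) (Set.powersetCard (Fin n) k) ℂ) := by
  obtain ⟨s, -, hs⟩ := Finset.exists_subset_card_eq (s := (Finset.univ : Finset (Fin n)))
    (n := k) (by simpa using hk)
  have : Nonempty (Set.powersetCard (Fin n) k) := ⟨⟨s, hs⟩⟩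
  infer_instance

lemma posSemidef_SG : (SG α p A B).PosSemidef := nonneg_iff_posSemidef.1 CFC.rpow_nonneg

lemma posSemidef_renyiMean : (renyiMean α q A B).PosSemidef :=
  nonneg_iff_posSemidef.1 CFC.rpow_nonneg

lemma logMaj_SG_renyiMean_of_posDef (hA : A.PosDef) (hB : B.PosSemidef) (hα0 : 0 < α)
    (hα1 : α < 1) (hp : 0 < p) (hq : 0 < q) (h : p / q ≤ min α (1 - α)) :
    LogMaj (SG α p A B) (renyiMean α q A B) := by
  refine logMaj_of_norm_compound_le posSemidef_SG posSemidef_renyiMean (fun k _ hkn => ?_)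
    (det_SG_eq_det_renyiMean hA hB hα0 hp hq)
  have := nontrivial_compound hkn
  rw [compound_SG hA.posSemidef hB, compound_renyiMean hA.posSemidef hB,
    CFC.norm_rpow _ (by positivity) (specMean_nonneg α CFC.rpow_nonneg _),
    CFC.norm_rpow _ (by positivity) (renyiInner_nonneg _ _ _ _)]
  calc _ ≤ (‖renyiInner α q (compound k A) (compound k B)‖ ^ (p / q)) ^ (1 / p) := by
        gcongr
        exact norm_specMean_le_of_nonneg (hA.compound).isStrictlyPositive hB.compound.nonneg
          hα0 hα1 hp hq h
    _ = _ := by rw [← Real.rpow_mul (norm_nonneg _)]; congr 1; field_simp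

lemma logMaj_renyiMean_SG_of_posDef (hA : A.PosDef) (hB : B.PosSemidef) (hα0 : 0 < α)
    (hα1 : α < 1) (hp : 0 < p) (hq : 0 < q) (h : max α (1 - α) ≤ p / q) :
    LogMaj (renyiMean α q A B) (SG α p A B) := by
  refine logMaj_of_norm_compound_le posSemidef_renyiMean posSemidef_SG (fun k _ hkn => ?_)
    (det_SG_eq_det_renyiMean hA hB hα0 hp hq).symm
  have := nontrivial_compound hkn
  rw [compound_SG hA.posSemidef hB, compound_renyiMean hA.posSemidef hB,
    CFC.norm_rpow _ (by positivity) (specMean_nonneg α CFC.rpow_nonneg _),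
    CFC.norm_rpow _ (by positivity) (renyiInner_nonneg _ _ _ _)]
  calc _ ≤ (‖specMean α (compound k A ^ p) (compound k B ^ p)‖ ^ (q / p)) ^ (1 / q) := by
        gcongr
        exact norm_renyiInner_le_of_nonneg (hA.compound).isStrictlyPositive hB.compound.nonneg
          hα0 hα1 hp hq h
    _ = _ := by rw [← Real.rpow_mul (norm_nonneg _)]; congr 1; field_simp

theorem logMaj_SG_renyiMean (hA : A.PosSemidef) (hB : B.PosSemidef)
    (hs : supportProj B ≤ supportProj A) (hα0 : 0 < α) (hα1 : α < 1) (hp : 0 < p) (hq : 0 < q)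
    (h : p / q ≤ min α (1 - α)) : LogMaj (SG α p A B) (renyiMean α q A B) := by
  rw [← SG_fillKer hA hB hs hα0 hp, ← renyiMean_fillKer hA hB hs hα0 hα1 hq]
  exact logMaj_SG_renyiMean_of_posDef hA.posDef_fillKer hB hα0 hα1 hp hq h

theorem logMaj_renyiMean_SG (hA : A.PosSemidef) (hB : B.PosSemidef)
    (hs : supportProj B ≤ supportProj A) (hα0 : 0 < α) (hα1 : α < 1) (hp : 0 < p) (hq : 0 < q)
    (h : max α (1 - α) ≤ p / q) : LogMaj (renyiMean α q A B) (SG α p A B) := by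
  rw [← SG_fillKer hA hB hs hα0 hp, ← renyiMean_fillKer hA hB hs hα0 hα1 hq]
  exact logMaj_renyiMean_SG_of_posDef hA.posDef_fillKer hB hα0 hα1 hp hq h

/-- The support of a positive definite matrix is everything. -/
lemma supportProj_le_of_posDef (hA : A.PosDef) (hB : B.PosSemidef) :
    supportProj B ≤ supportProj A := by
  have hAsa : IsSelfAdjoint A := hA.isHermitian
  have h1 : supportProj A = 1 := by
    rw [supportProj, ← cfc_one ℝ A]
    refine cfc_congr fun x hx => ?_
    have : x ≠ 0 := fun h0 => spectrum.zero_notMem ℝ hA.isUnit (h0 ▸ hx)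
    simp [this]
  rw [h1]
  exact (isStarProjection_supportProj hB).le_one

end Sufficiency
end Matrix

/-! ### Necessity: the means at a projection. -/

section Projection

open CFC Filter Topology

variable {𝒜 : Type*} [CStarAlgebra 𝒜] [PartialOrder 𝒜] [StarOrderedRing 𝒜] {α p q : ℝ}

lemma IsStarProjection.rpow_eq {e : 𝒜} (he : IsStarProjection e) {r : ℝ} (hr : r ≠ 0) :
    e ^ r = e := by
  have hsa := he.isSelfAdjoint
  have h0 : ∀ x ∈ spectrum ℝ e, x = 0 ∨ x = 1 := fun x hx =>
    he.isIdempotentElem.spectrum_subset ℝ hx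
  rw [rpow_eq_cfc_real he.nonneg]
  conv_rhs => rw [← cfc_id ℝ e]
  refine cfc_congr fun x hx => ?_
  rcases h0 x hx with rfl | rfl <;> simp [hr]

/-- A multiple c e solves the Riccati equation exactly when c² m e = e. -/
lemma IsStarProjection.invGeoMean_eq {x e : 𝒜} (he : IsStarProjection e)
    (hx : IsStrictlyPositive x) {m : ℝ} (hm : 0 < m) (h : e * x * e = m • e) :
    invGeoMean x e = m ^ (-(1 / 2) : ℝ) • e := by
  refine eq_invGeoMean_of_mul_mul_self hx (smul_nonneg (by positivity) he.nonneg) ?_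
  simp only [smul_mul_assoc, mul_smul_comm, h, smul_smul]
  rw [← mul_assoc, ← Real.rpow_add hm, ← Real.rpow_add_one hm.ne']
  norm_num

lemma IsStarProjection.specMean_eq {x e : 𝒜} (he : IsStarProjection e)
    (hx : IsStrictlyPositive x) {m : ℝ} (hm : 0 < m) (h : e * x * e = m • e) (hα0 : 0 < α) :
    specMean α x e = m ^ (1 - α) • e := by
  rw [specMean, he.invGeoMean_eq hx hm h,
    smul_rpow_of_nonneg (by positivity) he.nonneg (Or.inr hα0.le), he.rpow_eq hα0.ne']
  simp only [smul_mul_assoc, mul_smul_comm, h, smul_smul]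
  congr 1
  rw [← mul_assoc, ← Real.rpow_mul hm.le, ← Real.rpow_add hm, ← Real.rpow_add_one hm.ne']
  congr 1; ring

lemma IsStarProjection.norm_renyiInner {a e : 𝒜} (he : IsStarProjection e)
    (ha : IsStrictlyPositive a) {m : ℝ} (hm : 0 < m)
    (h : e * a ^ ((1 - α) * q) * e = m • e) (hα0 : 0 < α) (hq : 0 < q) :
    ‖renyiInner α q a e‖ = m * ‖e‖ := by
  rw [renyiInner, he.rpow_eq (by positivity)]
  set r := (1 - α) / 2 * q with hr
  have h1 : a ^ r * e * a ^ r = star (e * a ^ r) * (e * a ^ r) := by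
    nth_rw 1 [← he.isIdempotentElem.eq]
    simp [(isSelfAdjoint_rpow a r).star_eq, he.isSelfAdjoint.star_eq, mul_assoc]
  have h2 : (e * a ^ r) * star (e * a ^ r) = m • e := by
    rw [← h, show (1 - α) * q = r + r by rw [hr]; ring, rpow_add ha.isUnit]
    simp [(isSelfAdjoint_rpow a r).star_eq, he.isSelfAdjoint.star_eq, mul_assoc]
  rw [h1, CStarRing.norm_star_mul_self, ← CStarRing.norm_self_mul_star, h2, norm_smul,
    Real.norm_of_nonneg hm.le]

end Projection

namespace Matrix

open scoped Matrix.Norms.L2Operator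

variable {α p q : ℝ}

lemma diagonal_rpow {ι : Type*} [Fintype ι] [DecidableEq ι] (d : ι → ℝ) (hd : ∀ i, 0 ≤ d i)
    (r : ℝ) : (diagonal fun i => (d i : ℂ)) ^ r = diagonal fun i => ((d i ^ r : ℝ) : ℂ) := by
  simpa using conj_diagonal_rpow 1 d hd r

/-- The rank-one projection onto the diagonal of `ℂ²`. -/
def halfOnes : Matrix (Fin 2) (Fin 2) ℂ := of fun _ _ => 1 / 2

lemma isStarProjection_halfOnes : IsStarProjection halfOnes := by
  constructor
  · rw [IsIdempotentElem]
    ext i j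
    simp [halfOnes, mul_apply]
  · rw [IsSelfAdjoint]
    ext i j
    simp [halfOnes, star_apply]

lemma halfOnes_ne_zero : halfOnes ≠ 0 := fun h => by
  have := congrFun (congrFun h 0) 0
  simp [halfOnes] at this

lemma halfOnes_mul_diagonal_mul_halfOnes (d : Fin 2 → ℝ) :
    halfOnes * diagonal (fun i => (d i : ℂ)) * halfOnes = ((d 0 + d 1) / 2) • halfOnes := by
  ext i j
  simp [halfOnes, mul_apply, diagonal_apply]
  ring

/-- The values of the two means at a diagonal matrix and the projection `halfOnes`. -/
lemma exists_norm_specMean_renyiInner (hα0 : 0 < α) (hp : 0 < p) (hq : 0 < q) :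
    ∃ A B : Matrix (Fin 2) (Fin 2) ℂ, A.PosDef ∧ B.PosSemidef ∧
      ‖specMean α (A ^ p) (B ^ p)‖ = 2 ^ (1 - α) ∧
      ‖renyiInner α q A B‖ = (1 + 3 ^ ((1 - α) * q / p)) / 2 := by
  -- Then A^p has diagonal 1, 3, whose average 2 is the compression factor by `halfOnes`.
  set d : Fin 2 → ℝ := ![1, 3 ^ (1 / p)] with hd
  have hd0 : ∀ i, 0 < d i := by
    intro i; fin_cases i
    · simp [hd]
    · simp only [hd]; simp; positivity
  have hA : (diagonal fun i => (d i : ℂ)).PosDef :=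
    PosDef.diagonal fun i => by simpa using hd0 i
  have hpow : ∀ r : ℝ, halfOnes * (diagonal fun i => (d i : ℂ)) ^ r * halfOnes =
      ((1 + 3 ^ (r / p)) / 2 : ℝ) • halfOnes := by
    intro r
    rw [diagonal_rpow d (fun i => (hd0 i).le), halfOnes_mul_diagonal_mul_halfOnes]
    congr 3
    · simp [hd]
    · simp only [hd, cons_val_one, cons_val_fin_one]
      rw [← Real.rpow_mul (by norm_num)]
      congr 1; ring
  have hn : ‖halfOnes‖ = 1 := by
    have h := CStarRing.norm_star_mul_self (x := halfOnes)
    rw [isStarProjection_halfOnes.isSelfAdjoint.star_eq,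
      isStarProjection_halfOnes.isIdempotentElem.eq] at h
    exact (mul_eq_left₀ (norm_ne_zero_iff.2 halfOnes_ne_zero)).1 h.symm
  refine ⟨diagonal fun i => (d i : ℂ), halfOnes, hA,
    nonneg_iff_posSemidef.1 isStarProjection_halfOnes.nonneg, ?_, ?_⟩
  · rw [isStarProjection_halfOnes.rpow_eq hp.ne',
      isStarProjection_halfOnes.specMean_eq (hA.isStrictlyPositive.rpow _ p) (m := 2) (by norm_num)
        (by rw [hpow]; congr 1; rw [div_self hp.ne', Real.rpow_one]; norm_num) hα0,
      norm_smul, hn, mul_one, Real.norm_of_nonneg (by positivity)]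
  · rw [isStarProjection_halfOnes.norm_renyiInner hA.isStrictlyPositive (by positivity)
      (hpow _) hα0 hq, hn, mul_one]

/-- Strict Jensen at the midpoint of 1 and 3. -/
lemma two_rpow_lt_of_one_lt {s : ℝ} (hs : 1 < s) : (2 : ℝ) ^ s < (1 + 3 ^ s) / 2 := by
  have h := (strictConvexOn_rpow hs).2 (show (1 : ℝ) ∈ Set.Ici 0 by norm_num)
    (show (3 : ℝ) ∈ Set.Ici 0 by norm_num) (by norm_num) (show (0 : ℝ) < 1 / 2 by norm_num)
    (show (0 : ℝ) < 1 / 2 by norm_num) (by norm_num)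
  norm_num at h
  linarith

lemma lt_two_rpow_of_lt_one {s : ℝ} (hs0 : 0 < s) (hs : s < 1) :
    (1 + 3 ^ s) / 2 < (2 : ℝ) ^ s := by
  have h := (Real.strictConcaveOn_rpow hs0 hs).2 (show (1 : ℝ) ∈ Set.Ici 0 by norm_num)
    (show (3 : ℝ) ∈ Set.Ici 0 by norm_num) (by norm_num) (show (0 : ℝ) < 1 / 2 by norm_num)
    (show (0 : ℝ) < 1 / 2 by norm_num) (by norm_num)
  norm_num at h
  linarith

lemma norm_SG (hp : 0 < p) (A B : Matrix (Fin 2) (Fin 2) ℂ) :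
    ‖SG α p A B‖ = ‖specMean α (A ^ p) (B ^ p)‖ ^ (1 / p) := by
  rw [SG_eq_specMean_rpow,
    CFC.norm_rpow _ (by positivity) (specMean_nonneg α CFC.rpow_nonneg _)]

lemma norm_renyiMean (hq : 0 < q) (A B : Matrix (Fin 2) (Fin 2) ℂ) :
    ‖renyiMean α q A B‖ = ‖renyiInner α q A B‖ ^ (1 / q) := by
  rw [renyiMean_eq_renyiInner_rpow,
    CFC.norm_rpow _ (by positivity) (renyiInner_nonneg _ _ _ _)]

/-- The hypothesis passes to the singular test matrix B by approximation; the strict gap in Jensen's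
inequality then contradicts it if p/q > 1 - α. -/
lemma le_one_sub_of_norm_SG_le (hα0 : 0 < α) (hα1 : α < 1) (hp : 0 < p) (hq : 0 < q)
    (h : ∀ A B : Matrix (Fin 2) (Fin 2) ℂ, A.PosDef → B.PosDef →
      ‖SG α p A B‖ ≤ ‖renyiMean α q A B‖) : p / q ≤ 1 - α := by
  obtain ⟨A, B, hA, hB, h1, h2⟩ := exists_norm_specMean_renyiInner (q := q) hα0 hp hq
  obtain ⟨f, hf, l1, l2⟩ := tendsto_norm_specMean_renyiInner (a := A) hB.nonneg hα0 hp hq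
  have hle : ‖specMean α (A ^ p) (B ^ p)‖ ^ (1 / p) ≤ ‖renyiInner α q A B‖ ^ (1 / q) := by
    refine le_of_tendsto_of_tendsto' (l1.rpow_const (Or.inr (by positivity)))
      (l2.rpow_const (Or.inr (by positivity))) fun n => ?_
    rw [← norm_SG hp, ← norm_renyiMean hq]
    exact h A (f n) hA (isStrictlyPositive_iff_posDef.1 (hf n))
  rw [h1, h2] at hle
  by_contra! hlt
  rw [lt_div_iff₀ hq] at hlt
  have hs := lt_two_rpow_of_lt_one (s := (1 - α) * q / p)
    (div_pos (mul_pos (by linarith) hq) hp) ((div_lt_one hp).2 hlt)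
  have := Real.rpow_lt_rpow (by positivity) hs (z := 1 / q) (by positivity)
  rw [← Real.rpow_mul (by norm_num)] at this hle
  refine absurd (this.trans_eq ?_) (not_lt.2 hle)
  congr 1; field_simp

lemma one_sub_le_of_norm_renyiMean_le (hα0 : 0 < α) (hp : 0 < p) (hq : 0 < q)
    (h : ∀ A B : Matrix (Fin 2) (Fin 2) ℂ, A.PosDef → B.PosDef →
      ‖renyiMean α q A B‖ ≤ ‖SG α p A B‖) : 1 - α ≤ p / q := by
  obtain ⟨A, B, hA, hB, h1, h2⟩ := exists_norm_specMean_renyiInner (q := q) hα0 hp hq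
  obtain ⟨f, hf, l1, l2⟩ := tendsto_norm_specMean_renyiInner (a := A) hB.nonneg hα0 hp hq
  have hle : ‖renyiInner α q A B‖ ^ (1 / q) ≤ ‖specMean α (A ^ p) (B ^ p)‖ ^ (1 / p) := by
    refine le_of_tendsto_of_tendsto' (l2.rpow_const (Or.inr (by positivity)))
      (l1.rpow_const (Or.inr (by positivity))) fun n => ?_
    rw [← norm_SG hp, ← norm_renyiMean hq]
    exact h A (f n) hA (isStrictlyPositive_iff_posDef.1 (hf n))
  rw [h1, h2] at hle
  by_contra! hlt
  rw [div_lt_iff₀ hq] at hlt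
  have hs := two_rpow_lt_of_one_lt (s := (1 - α) * q / p) ((one_lt_div hp).2 hlt)
  have := Real.rpow_lt_rpow (by positivity) hs (z := 1 / q) (by positivity)
  rw [← Real.rpow_mul (by norm_num)] at this hle
  refine absurd (lt_of_eq_of_lt ?_ this) (not_lt.2 hle)
  congr 1; field_simp

lemma norm_SG_swap {A B : Matrix (Fin 2) (Fin 2) ℂ} (hA : A.PosDef) (hB : B.PosDef)
    (hp : 0 < p) : ‖SG (1 - α) p B A‖ = ‖SG α p A B‖ := by
  rw [norm_SG hp, norm_SG hp,
    specMean_swap (hA.isStrictlyPositive.rpow _ p) (hB.isStrictlyPositive.rpow _ p)]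

lemma norm_renyiMean_swap {A B : Matrix (Fin 2) (Fin 2) ℂ} (hA : A.PosDef) (hB : B.PosDef)
    (hq : 0 < q) : ‖renyiMean (1 - α) q B A‖ = ‖renyiMean α q A B‖ := by
  rw [norm_renyiMean hq, norm_renyiMean hq,
    norm_renyiInner_swap hA.isStrictlyPositive hB.isStrictlyPositive]

end Matrix

open Matrix

theorem theorem3p3 (α p q : ℝ) (hα0 : 0 < α) (hα1 : α < 1) (hp : 0 < p) (hq : 0 < q) :
    List.TFAE
      [∀ (n : ℕ) (A B : Matrix (Fin n) (Fin n) ℂ), A.PosSemidef → B.PosSemidef →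
          supportProj B ≤ supportProj A → LogMaj (SG α p A B) (renyiMean α q A B),
        ∀ A B : Matrix (Fin 2) (Fin 2) ℂ, A.PosDef → B.PosDef →
          LogMaj (SG α p A B) (renyiMean α q A B),
        p / q ≤ min α (1 - α)] ∧
    List.TFAE
      [∀ (n : ℕ) (A B : Matrix (Fin n) (Fin n) ℂ), A.PosSemidef → B.PosSemidef →
          supportProj B ≤ supportProj A → LogMaj (renyiMean α q A B) (SG α p A B),
        ∀ A B : Matrix (Fin 2) (Fin 2) ℂ, A.PosDef → B.PosDef →
          LogMaj (renyiMean α q A B) (SG α p A B),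
        max α (1 - α) ≤ p / q] := by
  constructor
  · tfae_have 1 → 2 := fun h A B hA hB =>
      h 2 A B hA.posSemidef hB.posSemidef (supportProj_le_of_posDef hA hB.posSemidef)
    tfae_have 2 → 3 := fun h => by
      refine le_min ?_ (le_one_sub_of_norm_SG_le hα0 hα1 hp hq fun A B hA hB =>
        (h A B hA hB).norm_le)
      -- Exchanging A and B replaces α by 1 - α, so the bound obtained is p/q ≤ 1 - (1 - α).
      have := le_one_sub_of_norm_SG_le (α := 1 - α) (by linarith) (by linarith) hp hq
        fun A B hA hB => by
          rw [norm_SG_swap hB hA hp, norm_renyiMean_swap hB hA hq]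
          exact (h B A hB hA).norm_le
      linarith
    tfae_have 3 → 1 := fun h n A B hA hB hs => logMaj_SG_renyiMean hA hB hs hα0 hα1 hp hq h
    tfae_finish
  · tfae_have 1 → 2 := fun h A B hA hB =>
      h 2 A B hA.posSemidef hB.posSemidef (supportProj_le_of_posDef hA hB.posSemidef)
    tfae_have 2 → 3 := fun h => by
      refine max_le ?_ (one_sub_le_of_norm_renyiMean_le hα0 hp hq fun A B hA hB =>
        (h A B hA hB).norm_le)
      have := one_sub_le_of_norm_renyiMean_le (α := 1 - α) (by linarith) hp hq
        fun A B hA hB => by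
          rw [norm_SG_swap hB hA hp, norm_renyiMean_swap hB hA hq]
          exact (h B A hB hA).norm_le
      linarith
    tfae_have 3 → 1 := fun h n A B hA hB hs => logMaj_renyiMean_SG hA hB hs hα0 hα1 hp hq h
    tfae_finish

end
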